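/- **Separation of linear 3-LCCs and 3-LDCs.** For a finite field $\mathbb{F}$, a map $\mathcal{L}\colon \mathbb{F}^k\to\mathbb{F}^n$ is a $(q,\delta,\varepsilon)$-locally correctable code (LCC) if there is a randomized algorithm $\mathrm{Dec}$ which, given $u\in[n]$ and oracle access to some $y\in\mathbb{F}^n$, makes at most $q$ (possibly adaptive) queries to $y$ and satisfies $\Pr[\mathrm{Dec}^y(u)=\mathcal{L}(b)_u]\ge \frac12+\varepsilon$ for all $b\in\mathbb{F}^k$, all $u\in[n]$ and all $y$ with Hamming distance $\Delta(y,\mathcal{L}(b))\le\delta n$. It is a $(q,\delta,\varepsilon)$-locally decodable code (LDC) if the same holds with only the message symbols to be recovered: $\Pr[\mathrm{Dec}^y(i)=b_i]\ge\frac12+\varepsilon$ for all $b\in\mathbb{F}^k$, all $i\in[k]$ and all $y$ with $\Delta(y,\mathcal{L}(b))\le\delta n$. A *binary matching vector code* is a map $\mathcal{L}\colon\mathbb{F}_2^k\to\mathbb{F}_2^n$ of the following form. There are $t\ge1$, an element $\gamma$ of order $m$ in the multiplicative group of $K=\mathbb{F}_{2^t}$, a number $h\ge 0$, and vectors $u_1,\dots,u_k,v_1,\dots,v_k\in(\mathbb{Z}/m)^h$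 with $\langle u_i,v_i\rangle=0$ for all $i$ and $\langle u_i,v_j\rangle\ne0$ for all $i\ne j$; the $n=2^t m^h$ coordinates of $\mathcal{L}$ are indexed by the pairs $(a,x)\in K\times(\mathbb{Z}/m)^h$, and $$\mathcal{L}(b)_{(a,x)}=\mathrm{Tr}_{K/\mathbb{F}_2}\Bigl(a\sum_{i=1}^k b_i\,\gamma^{\langle u_i,x\rangle}\Bigr).$$ Then: 1. *(Linear 3-LDCs of subexponential length.)* There are constants $\delta,\varepsilon,C>0$ such that for every $k\ge3$ there are an $n\le\exp\bigl(\exp\bigl(C\sqrt{\log k}\,\log\log k\bigr)\bigr)$ and an injective linear map $\mathcal{L}\colon\mathbb{F}_2^k\to\mathbb{F}_2^n$ that is a binary matching vector code and a $(3,\delta,\varepsilon)$-LDC. 2. *(Linear 3-LCCs need exponential length.)* There is an absolute constant $c>0$ such that for every finite field $\mathbb{F}$, all $k\ge 0$, $n\ge2$ and $\delta,\varepsilon>0$, and every injective linear map $\mathcal{L}\colon\mathbb{F}^k\to\mathbb{F}^n$ that is a $(3,\delta,\varepsilon)$-LCC, $$n\ \ge\ 2^{\,c\,\left(\delta^2k/(|\mathbb{F}|-1)^2\right)^{1/8}}.$$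 3. *(Those matching vector codes have no 3-query local correction.)* For all constants $C$ and $\delta>0$ there is a $K$ such that for all $k\ge K$, no injective linear map $\mathcal{L}\colon\mathbb{F}_2^k\to\mathbb{F}_2^n$ with $n\le\exp\bigl(\exp\bigl(C\sqrt{\log k}\,\log\log k\bigr)\bigr)$ is a $(3,\delta,\varepsilon)$-LCC for any $\varepsilon>0$. In particular, for all large enough $k$ the codes in (1) are not. -/

import Mathlib

open scoped Matrix

/-- A deterministic (adaptive) algorithm with oracle access to a string in `F ^ n`: a decision
tree that either stops with an output, or queries a coordinate and continues according to
the symbol that it reads. -/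
inductive QueryTree (n : ℕ) (F : Type) : Type
  | output (a : F) : QueryTree n F
  | query (v : Fin n) (next : F → QueryTree n F) : QueryTree n F

namespace QueryTree

/-- The output of the algorithm on the oracle `y`. -/
def run {n : ℕ} {F : Type} (y : Fin n → F) : QueryTree n F → F
  | output a => a
  | query v next => (next (y v)).run y

/-- The number of queries that the algorithm makes on the oracle `y`. -/
def numQueries {n : ℕ} {F : Type} (y : Fin n → F) : QueryTree n F → ℕ
  | output _ => 0
  | query v next => (next (y v)).numQueries y + 1

end QueryTree

/-- A randomized algorithm (a random choice of a deterministic one) makes at most `q` queries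
on every oracle, whatever its random choices. -/
def MakesAtMostQueries {n : ℕ} {F : Type} (q : ℕ) (D : PMF (QueryTree n F)) : Prop :=
  ∀ T ∈ D.support, ∀ y : Fin n → F, T.numQueries y ≤ q

/-- The probability that the randomized algorithm `D` outputs `a` on the oracle `y`. -/
noncomputable def outputProb {n : ℕ} {F : Type} (D : PMF (QueryTree n F)) (y : Fin n → F)
    (a : F) : ℝ :=
  ((D.map fun T => T.run y) a).toReal

/-- `L : F ^ k → F ^ n` is a `(q, δ, ε)`-locally correctable code: there is a randomized
`q`-query algorithm that recovers, for every `u ∈ [n]`, the codeword symbol `L(b)_u` with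
probability at least `1/2 + ε` from every `y` at Hamming distance at most `δ n` from `L(b)`. -/
def IsLCC {F : Type} [DecidableEq F] {k n : ℕ} (q : ℕ) (δ ε : ℝ)
    (L : (Fin k → F) → (Fin n → F)) : Prop :=
  ∃ Dec : Fin n → PMF (QueryTree n F),
    (∀ u, MakesAtMostQueries q (Dec u)) ∧
    ∀ (b : Fin k → F) (u : Fin n) (y : Fin n → F),
      (hammingDist y (L b) : ℝ) ≤ δ * n → (1 / 2 : ℝ) + ε ≤ outputProb (Dec u) y (L b u)

/-- `L : F ^ k → F ^ n` is a `(q, δ, ε)`-locally decodable code: as for `IsLCC`, but only the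
message symbols `b_i`, `i ∈ [k]`, have to be recovered. -/
def IsLDC {F : Type} [DecidableEq F] {k n : ℕ} (q : ℕ) (δ ε : ℝ)
    (L : (Fin k → F) → (Fin n → F)) : Prop :=
  ∃ Dec : Fin k → PMF (QueryTree n F),
    (∀ i, MakesAtMostQueries q (Dec i)) ∧
    ∀ (b : Fin k → F) (i : Fin k) (y : Fin n → F),
      (hammingDist y (L b) : ℝ) ≤ δ * n → (1 / 2 : ℝ) + ε ≤ outputProb (Dec i) y (b i)

/-- A family of matching vectors in `(ℤ/m) ^ h`: `⟨u_i, v_i⟩ = 0` for all `i`, and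
`⟨u_i, v_j⟩ ≠ 0` for all `i ≠ j`. -/
structure IsMatchingVectorFamily {m h k : ℕ} (u v : Fin k → Fin h → ZMod m) : Prop where
  diag : ∀ i, u i ⬝ᵥ v i = 0
  off_diag : ∀ i j, i ≠ j → u i ⬝ᵥ v j ≠ 0

/-- The symbol at the position `x ∈ (ℤ/m) ^ h` of the encoding of `b` by the matching vector code
of `u_1, …, u_k` over the field `K`, namely `∑ i, b_i γ ^ ⟨u_i, x⟩`, where `γ` has order `m`. -/
def matchingVectorSymbol {K : Type} [Field K] {m h k : ℕ} (γ : Kˣ)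
    (u : Fin k → Fin h → ZMod m) (b : Fin k → K) (x : Fin h → ZMod m) : K :=
  ∑ i, b i * (γ : K) ^ (u i ⬝ᵥ x).val

/-- `L : 𝔽₂ ^ k → 𝔽₂ ^ n` is a binary matching vector code: the restriction to binary messages of a
matching vector code over a field `K = 𝔽_{2^t}`, each of whose symbols `s ∈ K` is then written out
in binary by the Hadamard code `(Tr (a s))_{a ∈ K}`. The coordinates of `L` are indexed by the pairs
`(a, x) ∈ K × (ℤ/m) ^ h`. -/
def IsBinaryMatchingVectorCode {k n : ℕ} (L : (Fin k → ZMod 2) → (Fin n → ZMod 2)) : Prop :=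
  ∃ (t m h : ℕ) (_ : 0 < t) (γ : (GaloisField 2 t)ˣ) (_ : orderOf γ = m)
    (u v : Fin k → Fin h → ZMod m) (_ : IsMatchingVectorFamily u v)
    (e : Fin n ≃ GaloisField 2 t × (Fin h → ZMod m)),
    ∀ (b : Fin k → ZMod 2) (p : Fin n),
      L b p = Algebra.trace (ZMod 2) (GaloisField 2 t)
        ((e p).1 * matchingVectorSymbol γ u
          (fun i => algebraMap (ZMod 2) (GaloisField 2 t) (b i)) (e p).2)

/-!
The first and the second part are independent, and the third compares their bounds.

*Short locally decodable codes.* Efremenko’s decoder for a matching vector code works if some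
polynomial with few terms vanishes at `γ ^ ⟨u_i, v_j⟩` for all `i ≠ j` but not at `1`: the symbols on
a line in the direction `v_i`, weighted by its coefficients, then add up to `b_i`. Modulo
`511 = 7 * 73` a polynomial with three terms suffices (`exists_trinomial`), provided that the products
`⟨u_i, v_j⟩` are nonzero idempotents. Grolmusz’s vectors have this property and are short
(`exists_matchingVectors`): by the theorem of Lucas, two binomial coefficients detect whether the
number of agreements of two bit strings is their length. The trace turns symbols into bits, at the
price of a factor two in the probability that a query is corrupted
(`binaryMatchingVectorCode_injective_and_isLDC`).

*Length of locally correctable codes.* In a linear 3-query code with distance parameter `δ`, every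
coordinate is spanned by each of about `δ n / 3` disjoint triples of coordinates
(`IsLCC.hasDisjointTriples`). Consider the `N = n |F|` symbols, that is, the multiples of the
coordinates. A walker at a symbol reads a random word of symbols. A spanning triple turns the current
symbol and a letter that is read into another letter and a new current symbol with the same sum, and
the walker makes this exchange with a small probability. So the joint law of the output word and the
final position has a sum which is a random sum translated by the initial symbol
(`ExchangeSystem.sum_density_histVal`). The entropy of this law grows in each step unless the laws for
most neighbours of the start are close to its own (`ExchangeSystem.potential_succ_ge`), and it is
bounded. Hence, after some number `T` of steps of order `δ⁻¹ |F| log n`, either all walkers are close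
to one that starts at zero, or some walker is close to a quarter of its neighbours
(`ExchangeSystem.exists_time_close`). Walkers with close laws give translates of the law of a random
sum that overlap, and this law lives on at most `N ^ T` points. By edge isoperimetry, the differences
of such starting points span a space of dimension `O(T log N)` (`finrank_span_mul_log_two_le`). Thus a
space of this dimension contains all coordinates or a positive fraction `δ / 12` of them. Passing to
quotients `O(1 / δ)` times gives `k = O(δ⁻² |F| log² n)` (`IsLCC.sq_mul_le`), which implies the second
part (`IsLCC.two_rpow_le`).
-/

/-! ### Local correction and disjoint spanning triples -/

namespace QueryTree

/-- The set of coordinates that the algorithm reads on the oracle `y`. -/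
def queried {n : ℕ} {F : Type} (y : Fin n → F) : QueryTree n F → Finset (Fin n)
  | output _ => ∅
  | query v next => insert v ((next (y v)).queried y)

theorem card_queried_le {n : ℕ} {F : Type} (y : Fin n → F) (T : QueryTree n F) :
    (T.queried y).card ≤ T.numQueries y := by
  induction T with
  | output a => simp [queried]
  | query v next ih =>
    simp only [queried, numQueries]
    exact (Finset.card_insert_le _ _).trans (Nat.succ_le_succ (ih _))

theorem run_congr {n : ℕ} {F : Type} {y y' : Fin n → F} (T : QueryTree n F)
    (h : ∀ v ∈ T.queried y, y' v = y v) :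
    T.run y' = T.run y ∧ T.queried y' = T.queried y := by
  induction T with
  | output a => simp [queried, run]
  | query v next ih =>
    have hv : y' v = y v := h v (by simp [queried])
    have := ih (y v) (fun w hw => h w (by simp [queried, hw]))
    simp [queried, run, hv, this.1, this.2]

end QueryTree

theorem outputProb_eq_sum {n : ℕ} {F : Type} [DecidableEq F] (D : PMF (QueryTree n F))
    (y : Fin n → F) (a : F) :
    (D.map fun T => T.run y) a = ∑' T, D T * (if T.run y = a then 1 else 0) := by
  rw [PMF.map_apply]
  refine tsum_congr fun T => ?_
  by_cases h : T.run y = a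
  · simp [h]
  · simp [h, Ne.symm h]

/-- If, for a family of oracles `y b`, every tree in the support of `D` is right about `val b` for
at most `N` indices `b`, then so is `D` on average. -/
theorem sum_outputProb_le {n : ℕ} {F B : Type} [DecidableEq F] [Fintype B]
    (D : PMF (QueryTree n F)) (y : B → Fin n → F) (val : B → F) (N : ℕ)
    (h : ∀ T ∈ D.support, (Finset.univ.filter fun b => T.run (y b) = val b).card ≤ N) :
    ∑ b, outputProb D (y b) (val b) ≤ N := by
  have key : ∑ b, (D.map fun T => T.run (y b)) (val b) ≤ (N : ENNReal) := by
    simp_rw [outputProb_eq_sum]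
    rw [← Summable.tsum_finsetSum (fun _ _ => ENNReal.summable)]
    calc ∑' T, ∑ b, D T * (if T.run (y b) = val b then 1 else 0)
        ≤ ∑' T, D T * (N : ENNReal) := by
          refine ENNReal.tsum_le_tsum fun T => ?_
          rw [← Finset.mul_sum]
          by_cases hT : T ∈ D.support
          · gcongr
            rw [Finset.sum_boole]
            exact_mod_cast h T hT
          · rw [PMF.mem_support_iff, not_not] at hT
            simp [hT]
      _ = N := by rw [ENNReal.tsum_mul_right, PMF.tsum_coe, one_mul]
  unfold outputProb
  rw [← ENNReal.toReal_sum (fun b _ => PMF.apply_ne_top _ _)]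
  calc _ ≤ (N : ENNReal).toReal := ENNReal.toReal_mono (by simp) key
    _ = N := by simp

/-- The `v`-th coordinate of the code, as a linear functional of the message. -/
def codeRow {F : Type} [Field F] {k n : ℕ} (L : (Fin k → F) →ₗ[F] (Fin n → F)) (v : Fin n) :
    (Fin k → F) →ₗ[F] F :=
  (LinearMap.proj v).comp L

/-- If the functional `codeRow L u` is not spanned by any `q` functionals outside of `T`, then any
`q`-query algorithm that reads `0` on `T` recovers the symbol `L b u` for at most one message `b`
in `|F|`. The messages fall into classes `b + c • φ`, where `φ` vanishes on all queried coordinates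
but not at `u`. -/
theorem card_correct_le {F : Type} [Field F] [Fintype F] [DecidableEq F] {k n q : ℕ}
    (L : (Fin k → F) →ₗ[F] (Fin n → F)) (u : Fin n) (T : Finset (Fin n))
    (hT : ∀ C : Finset (Fin n), C.card ≤ q → Disjoint C T →
      codeRow L u ∉ Submodule.span F (codeRow L '' C))
    (A : QueryTree n F) (hA : ∀ y, A.numQueries y ≤ q) :
    Fintype.card F * (Finset.univ.filter fun b : Fin k → F =>
      A.run (fun v => if v ∈ T then 0 else L b v) = L b u).card ≤ Fintype.card F ^ k := by
  classical
  set Y : (Fin k → F) → Fin n → F := fun b v => if v ∈ T then 0 else L b v with hY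
  have hφ : ∀ Q : Finset (Fin n), ∃ φ : Fin k → F, Q.card ≤ q →
      L φ u = 1 ∧ ∀ v ∈ Q, v ∉ T → L φ v = 0 := by
    intro Q
    by_cases hQ : Q.card ≤ q
    swap
    · exact ⟨0, fun h => absurd h hQ⟩
    have h1 := hT (Q \ T) ((Finset.card_le_card Finset.sdiff_subset).trans hQ)
      Finset.sdiff_disjoint
    have h2 : ¬ (⨅ v : (Q \ T : Finset (Fin n)), LinearMap.ker (codeRow L v)) ≤
        LinearMap.ker (codeRow L u) := by
      intro hle
      apply h1
      have := mem_span_of_iInf_ker_le_ker hle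
      convert this using 2
      ext f
      simp
    rw [SetLike.not_le_iff_exists] at h2
    obtain ⟨x, hx, hxu⟩ := h2
    rw [Submodule.mem_iInf] at hx
    have hxu' : L x u ≠ 0 := hxu
    refine ⟨(L x u)⁻¹ • x, fun _ => ⟨by simp [hxu'], fun v hv hvT => ?_⟩⟩
    have : L x v = 0 := hx ⟨v, by simp [hv, hvT]⟩
    simp [this]
  choose φ hφ using hφ
  set Q : (Fin k → F) → Finset (Fin n) := fun b => A.queried (Y b) with hQ
  have hQq : ∀ b, (Q b).card ≤ q := fun b => (A.card_queried_le _).trans (hA _)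
  have hshift : ∀ (b : Fin k → F) (c : F),
      A.run (Y (b + c • φ (Q b))) = A.run (Y b) ∧ Q (b + c • φ (Q b)) = Q b := by
    intro b c
    apply A.run_congr
    intro v hv
    simp only [hY]
    split_ifs with hvT
    · rfl
    · simp [(hφ (Q b) (hQq b)).2 v hv hvT]
  let e : F → Equiv.Perm (Fin k → F) := fun c =>
    { toFun := fun b => b + c • φ (Q b)
      invFun := fun b => b + (-c) • φ (Q b)
      left_inv := fun b => by
        show (b + c • φ (Q b)) + (-c) • φ (Q (b + c • φ (Q b))) = b
        rw [(hshift b c).2]; simp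
      right_inv := fun b => by
        show (b + (-c) • φ (Q b)) + c • φ (Q (b + (-c) • φ (Q b))) = b
        rw [(hshift b (-c)).2]; simp }
  -- translation by `c • φ` permutes the messages, preserves the answer and adds `c` to
  -- the symbol
  have hcount : Fintype.card F * (Finset.univ.filter fun b => A.run (Y b) = L b u).card =
      ∑ b : Fin k → F, (Finset.univ.filter fun c : F => A.run (Y b) = L b u + c).card := by
    simp only [Finset.card_filter]
    rw [Finset.sum_comm]
    have : ∀ c : F, (∑ b : Fin k → F, if A.run (Y b) = L b u + c then 1 else 0) =
        ∑ b : Fin k → F, if A.run (Y b) = L b u then 1 else 0 := by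
      intro c
      rw [← Equiv.sum_comp (e c) (fun b => if A.run (Y b) = L b u then (1 : ℕ) else 0)]
      refine Finset.sum_congr rfl fun b _ => ?_
      show _ = if A.run (Y (b + c • φ (Q b))) = L (b + c • φ (Q b)) u then 1 else 0
      rw [(hshift b c).1]
      simp [(hφ (Q b) (hQq b)).1]
    rw [Finset.sum_congr rfl fun c _ => this c]
    simp
  rw [hcount]
  calc _ ≤ ∑ b : Fin k → F, 1 := by
        refine Finset.sum_le_sum fun b _ => ?_
        rw [Finset.card_le_one]
        intro c hc c' hc'
        simp only [Finset.mem_filter, Finset.mem_univ, true_and] at hc hc'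
        exact add_left_cancel (hc.symm.trans hc')
    _ = Fintype.card F ^ k := by simp

/-- In a linear locally correctable code, every coordinate is a linear combination of at most `q`
coordinates outside of any given set of `δ n` coordinates. -/
theorem IsLCC.exists_span {F : Type} [Field F] [Fintype F] [DecidableEq F] {k n q : ℕ}
    {L : (Fin k → F) →ₗ[F] (Fin n → F)} {δ ε : ℝ} (hε : 0 < ε) (h : IsLCC q δ ε L)
    (u : Fin n) (T : Finset (Fin n)) (hT : (T.card : ℝ) ≤ δ * n) :
    ∃ C : Finset (Fin n), C.card ≤ q ∧ Disjoint C T ∧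
      codeRow L u ∈ Submodule.span F (codeRow L '' C) := by
  by_contra! hcon
  obtain ⟨Dec, hq, hdec⟩ := h
  -- the decoder is run on the codeword with the symbols on `T` erased, which hides nothing but `T`
  set Y : (Fin k → F) → Fin n → F := fun b v => if v ∈ T then 0 else L b v with hY
  have h1 : ∀ b, (1 / 2 : ℝ) + ε ≤ outputProb (Dec u) (Y b) (L b u) := by
    intro b
    apply hdec
    refine le_trans ?_ hT
    have : (Finset.univ.filter fun v => Y b v ≠ L b v) ⊆ T := by
      intro v hv
      by_contra hvT
      simp [hY, hvT] at hv
    exact_mod_cast Finset.card_le_card this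
  have hF : 2 ≤ Fintype.card F := Fintype.one_lt_card
  have h2 := sum_outputProb_le (Dec u) Y (fun b => L b u) (Fintype.card F ^ k / 2) (by
    intro A hA
    have := card_correct_le L u T hcon A (hq u A hA)
    rw [Nat.le_div_iff_mul_le two_pos]
    calc _ ≤ _ * Fintype.card F := Nat.mul_le_mul_left _ hF
      _ ≤ _ := by rw [mul_comm]; exact this)
  have h3 : (Fintype.card F ^ k : ℝ) * (1 / 2 + ε) ≤ (Fintype.card F ^ k / 2 : ℕ) := by
    refine le_trans ?_ h2
    calc _ = ∑ b : Fin k → F, ((1 : ℝ) / 2 + ε) := by simp [mul_add]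
      _ ≤ _ := Finset.sum_le_sum fun b _ => h1 b
  have h4 : ((Fintype.card F ^ k / 2 : ℕ) : ℝ) ≤ (Fintype.card F ^ k : ℝ) / 2 := by
    exact_mod_cast Nat.cast_div_le (α := ℝ) (m := Fintype.card F ^ k) (n := 2)
  have h5 : (0 : ℝ) < Fintype.card F ^ k := by positivity
  nlinarith

/-- `m` disjoint triples of vectors of the family `a`, each of which spans `a v`. -/
def HasDisjointTriples (F : Type) [Field F] {G : Type} [AddCommGroup G] [Module F G] {n : ℕ}
    (a : Fin n → G) (m : ℕ) (v : Fin n) : Prop :=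
  ∃ (p : Fin m × Fin 3 → Fin n) (c : Fin m → Fin 3 → F), Function.Injective p ∧
    ∀ i, a v = ∑ j, c i j • a (p (i, j))

theorem HasDisjointTriples.map {F : Type} [Field F] {G G' : Type} [AddCommGroup G] [Module F G]
    [AddCommGroup G'] [Module F G'] {n m : ℕ} {a : Fin n → G} {v : Fin n}
    (h : HasDisjointTriples F a m v) (f : G →ₗ[F] G') : HasDisjointTriples F (f ∘ a) m v := by
  obtain ⟨p, c, hp, hc⟩ := h
  refine ⟨p, c, hp, fun i => ?_⟩
  simp only [Function.comp]
  rw [hc i]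
  simp

/-- Disjoint triples are found greedily: a set of at most three coordinates that avoids the
triples found so far is enlarged to a triple. The last step has to avoid only `3 (m - 1)`
coordinates, whence the summand `3`. -/
theorem IsLCC.hasDisjointTriples {F : Type} [Field F] [Fintype F] [DecidableEq F] {k n : ℕ}
    {L : (Fin k → F) →ₗ[F] (Fin n → F)} {δ ε : ℝ} (hε : 0 < ε) (h : IsLCC 3 δ ε L)
    (u : Fin n) (m : ℕ) (hm : ((3 * m : ℕ) : ℝ) ≤ δ * n + 3) (hmn : 3 * m ≤ n) :
    HasDisjointTriples F (codeRow L) m u := by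
  induction m with
  | zero => exact ⟨fun i => i.1.elim0, fun i => i.elim0, fun i => i.1.elim0, fun i => i.elim0⟩
  | succ m ih =>
    obtain ⟨p, c, hp, hc⟩ := ih (by push_cast at hm ⊢; linarith) (by omega)
    set T : Finset (Fin n) := Finset.univ.image p with hT
    have hTc : T.card = 3 * m := by
      rw [hT, Finset.card_image_of_injective _ hp]; simp [mul_comm]
    obtain ⟨C, hC3, hCT, hspan⟩ := h.exists_span hε u T (by
      rw [hTc]; push_cast at hm ⊢; linarith)
    obtain ⟨C', hCC', hC'T, hC'⟩ := Finset.exists_subsuperset_card_eq (s := C) (t := Tᶜ) (n := 3)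
      (by rwa [Finset.subset_compl_iff_disjoint_right]) hC3
      (by rw [Finset.card_compl, hTc]; simp; omega)
    let e : Fin 3 ≃ C' := (Finset.equivFinOfCardEq hC').symm
    have hmem : codeRow L u ∈ Submodule.span F (Set.range fun j : Fin 3 => codeRow L (e j)) := by
      refine Submodule.span_mono ?_ hspan
      rintro _ ⟨v, hv, rfl⟩
      exact ⟨e.symm ⟨v, hCC' hv⟩, by simp⟩
    obtain ⟨d, hd⟩ := (Submodule.mem_span_range_iff_exists_fun F).1 hmem
    refine ⟨fun x => Fin.lastCases (motive := fun _ => Fin n) (e x.2) (fun i => p (i, x.2)) x.1,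
      fun i => Fin.lastCases (motive := fun _ => Fin 3 → F) d c i, ?_, ?_⟩
    · have hne : ∀ (i : Fin m) (j j' : Fin 3), p (i, j) ≠ e j' := by
        intro i j j' heq
        have h1 := hC'T (e j').2
        rw [Finset.mem_compl, ← heq] at h1
        exact h1 (Finset.mem_image_of_mem _ (Finset.mem_univ _))
      rintro ⟨i, j⟩ ⟨i', j'⟩ heq
      induction i using Fin.lastCases with
      | last =>
        induction i' using Fin.lastCases with
        | last =>
          simp only [Fin.lastCases_last] at heq
          rw [e.injective (Subtype.ext heq)]
        | cast i' =>
          simp only [Fin.lastCases_last, Fin.lastCases_castSucc] at heq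
          exact absurd heq.symm (hne _ _ _)
      | cast i =>
        induction i' using Fin.lastCases with
        | last =>
          simp only [Fin.lastCases_last, Fin.lastCases_castSucc] at heq
          exact absurd heq (hne _ _ _)
        | cast i' =>
          simp only [Fin.lastCases_castSucc] at heq
          have := hp heq
          simp only [Prod.mk.injEq] at this ⊢
          simp [this.1, this.2]
    · intro i
      induction i using Fin.lastCases with
      | last => simp only [Fin.lastCases_last]; exact hd.symm
      | cast i => simp only [Fin.lastCases_castSucc]; exact hc i

/-! ### Edge isoperimetry and overlapping translates -/

theorem mul_log_add_mul_log_le {a b : ℝ} (ha : 0 < a) (hb : 0 < b) :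
    a * Real.log a + b * Real.log b + min a b * Real.log 2 ≤ (a + b) * Real.log (a + b) := by
  wlog hab : a ≤ b generalizing a b
  · have := this hb ha (le_of_not_ge hab)
    rw [min_comm, add_comm a b]; linarith
  rw [min_eq_left hab]
  have h1 : Real.log (2 * a) ≤ Real.log (a + b) := Real.log_le_log (by positivity) (by linarith)
  rw [Real.log_mul two_ne_zero ha.ne'] at h1
  have h2 : Real.log b ≤ Real.log (a + b) := Real.log_le_log hb (by linarith)
  nlinarith

section Isoperimetry

variable {F G ι : Type} [Field F] [AddCommGroup G] [Module F G] [DecidableEq G] [Fintype ι]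

/-- Edge isoperimetry in the Cayley graph of linearly independent generators `d i`: a set `S` spans
at most `2 |S| log₂ |S|` arcs. The functionals `ℓ i` are dual to the `d i`. The set is split in two
according to the value of some `ℓ i`, and only arcs of direction `i` join the two parts. -/
theorem sum_card_arcs_le [DecidableEq F] [DecidableEq ι] (d : ι → G) (l : ι → G →ₗ[F] F)
    (hl : ∀ i j, l i (d j) = if i = j then 1 else 0) (S : Finset G) :
    ((∑ i, (S.filter fun x => x + d i ∈ S).card : ℕ) : ℝ) * Real.log 2 ≤
      2 * (S.card * Real.log S.card) := by
  induction S using Finset.strongInduction with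
  | H S ih =>
  by_cases hS : ∀ i, S.filter (fun x => x + d i ∈ S) = ∅
  · have : (∑ i, (S.filter fun x => x + d i ∈ S).card : ℕ) = 0 := by simp [hS]
    rw [this]
    have := Real.log_natCast_nonneg S.card
    simp only [Nat.cast_zero, zero_mul]; positivity
  push Not at hS
  obtain ⟨i, x, hx⟩ := hS
  rw [Finset.mem_filter] at hx
  set S₁ := S.filter fun y => l i y = l i x with hS₁
  set S₂ := S.filter fun y => ¬ l i y = l i x with hS₂
  have hx1 : x ∈ S₁ := by simp [hS₁, hx.1]
  have hx2 : x + d i ∈ S₂ := by simp [hS₂, hx.2, hl]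
  have hss1 : S₁ ⊂ S := by
    refine Finset.ssubset_iff_subset_ne.2 ⟨Finset.filter_subset _ _, fun h => ?_⟩
    rw [← h] at hx
    exact (Finset.mem_filter.1 hx2).2 (Finset.mem_filter.1 hx.2).2
  have hss2 : S₂ ⊂ S := by
    refine Finset.ssubset_iff_subset_ne.2 ⟨Finset.filter_subset _ _, fun h => ?_⟩
    rw [← h] at hx
    exact (Finset.mem_filter.1 hx.1).2 rfl
  have hcard : S₁.card + S₂.card = S.card := Finset.card_filter_add_card_filter_not _
  -- the arcs that join the two parts have direction `i`
  have harcs : ∀ j, (S.filter fun y => y + d j ∈ S).card ≤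
      (S₁.filter fun y => y + d j ∈ S₁).card + (S₂.filter fun y => y + d j ∈ S₂).card +
        (if j = i then 2 * min S₁.card S₂.card else 0) := by
    intro j
    have hsub : (S.filter fun y => y + d j ∈ S) ⊆
        ((S₁.filter fun y => y + d j ∈ S₁) ∪ (S₂.filter fun y => y + d j ∈ S₂)) ∪
          ((S₁.filter fun y => y + d j ∈ S₂) ∪ (S₂.filter fun y => y + d j ∈ S₁)) := by
      intro y hy
      simp only [hS₁, hS₂, Finset.mem_filter, Finset.mem_union] at hy ⊢
      tauto
    refine (Finset.card_le_card hsub).trans ((Finset.card_union_le _ _).trans ?_)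
    refine Nat.add_le_add (Finset.card_union_le _ _) ?_
    split_ifs with hji
    · have hinj : ∀ A B : Finset G, (A.filter fun y => y + d j ∈ B).card ≤ min A.card B.card := by
        intro A B
        refine le_min (Finset.card_filter_le _ _) ?_
        refine Finset.card_le_card_of_injOn (fun y => y + d j) ?_ ?_
        · intro y hy; simp at hy; exact hy.2
        · intro y _ z _ h; exact add_right_cancel h
      refine (Finset.card_union_le _ _).trans ?_
      have h1 := hinj S₁ S₂
      have h2 := hinj S₂ S₁
      rw [min_comm] at h2
      omega
    · have h0 : (S₁.filter fun y => y + d j ∈ S₂) ∪ (S₂.filter fun y => y + d j ∈ S₁) = ∅ := by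
        rw [Finset.eq_empty_iff_forall_notMem]
        intro y hy
        have hlij : l i (d j) = 0 := by rw [hl, if_neg (Ne.symm hji)]
        simp only [hS₁, hS₂, Finset.mem_filter, Finset.mem_union, map_add, hlij, add_zero] at hy
        tauto
      rw [h0]; simp
  have hsum : (∑ j, (S.filter fun y => y + d j ∈ S).card : ℕ) ≤
      (∑ j, (S₁.filter fun y => y + d j ∈ S₁).card) +
      (∑ j, (S₂.filter fun y => y + d j ∈ S₂).card) + 2 * min S₁.card S₂.card := by
    refine (Finset.sum_le_sum fun j _ => harcs j).trans ?_
    rw [Finset.sum_add_distrib, Finset.sum_add_distrib]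
    simp
  have h1 := ih S₁ hss1
  have h2 := ih S₂ hss2
  have hp1 : (0 : ℝ) < S₁.card := by exact_mod_cast Finset.card_pos.2 ⟨_, hx1⟩
  have hp2 : (0 : ℝ) < S₂.card := by exact_mod_cast Finset.card_pos.2 ⟨_, hx2⟩
  have h3 := mul_log_add_mul_log_le hp1 hp2
  have hsumR : ((∑ j, (S.filter fun y => y + d j ∈ S).card : ℕ) : ℝ) ≤
      (∑ j, (S₁.filter fun y => y + d j ∈ S₁).card : ℕ) +
      (∑ j, (S₂.filter fun y => y + d j ∈ S₂).card : ℕ) +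
        2 * min (S₁.card : ℝ) S₂.card := by exact_mod_cast hsum
  rw [← hcard]
  have hl2 : 0 < Real.log 2 := Real.log_pos one_lt_two
  push_cast at h3 ⊢
  push_cast at hsumR h1 h2
  nlinarith [mul_le_mul_of_nonneg_right hsumR hl2.le]

/-- The functional form of `sum_card_arcs_le`, obtained by cutting `f` into layers. -/
theorem sum_min_shift_le [DecidableEq F] [DecidableEq ι] [Fintype G] (d : ι → G)
    (l : ι → G →ₗ[F] F) (hl : ∀ i j, l i (d j) = if i = j then 1 else 0) (M : ℕ) (f : G → ℝ)
    (hf : ∀ x, 0 ≤ f x) (hM : (Finset.univ.filter fun x => f x ≠ 0).card ≤ M) :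
    (∑ i, ∑ x, min (f x) (f (x + d i))) * Real.log 2 ≤ 2 * (Real.log M * ∑ x, f x) := by
  induction hs : (Finset.univ.filter fun x => f x ≠ 0).card using Nat.strong_induction_on
    generalizing f with
  | _ s ih =>
  set S := Finset.univ.filter fun x => f x ≠ 0 with hS
  have hmemS : ∀ x, x ∈ S ↔ f x ≠ 0 := by simp [hS]
  rcases S.eq_empty_or_nonempty with hSe | hSn
  · have : ∀ x, f x = 0 := by
      intro x; by_contra h; have := (hmemS x).2 h; simp [hSe] at this
    simp [this]
  obtain ⟨x₀, hx₀, hmin⟩ := S.exists_min_image f hSn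
  set c := f x₀ with hc
  have hc0 : 0 < c := lt_of_le_of_ne (hf _) (Ne.symm ((hmemS _).1 hx₀))
  -- the lowest layer of `f` is `c` times the indicator of its support `S`; `g` is the rest
  set g : G → ℝ := fun x => if x ∈ S then f x - c else 0 with hg
  have hfg : ∀ x, f x = g x + c * (if x ∈ S then 1 else 0) := by
    intro x
    by_cases h : x ∈ S
    · simp [hg, h]
    · have : f x = 0 := by by_contra h'; exact h ((hmemS x).2 h')
      simp [hg, h, this]
  have hg0 : ∀ x, 0 ≤ g x := by
    intro x
    by_cases h : x ∈ S
    · simp [hg, h, hmin x h]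
    · simp [hg, h]
  have hgS : (Finset.univ.filter fun x => g x ≠ 0) ⊂ S := by
    rw [Finset.ssubset_iff_of_subset]
    · exact ⟨x₀, hx₀, by simp [hg, hx₀, ← hc]⟩
    · intro x hx
      simp only [hg, Finset.mem_filter, Finset.mem_univ, true_and, ne_eq, ite_eq_right_iff,
        Classical.not_imp] at hx
      exact hx.1
  have hlt := Finset.card_lt_card hgS
  have h1 := ih _ (hs ▸ hlt) g hg0 (hlt.le.trans hM) rfl
  have h2 := sum_card_arcs_le d l hl S
  have hlog : Real.log S.card ≤ Real.log M :=
    Real.log_le_log (by exact_mod_cast Finset.card_pos.2 hSn) (by exact_mod_cast hM)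
  have hminfg : ∀ x y, min (f x) (f y) =
      min (g x) (g y) + c * (if x ∈ S ∧ y ∈ S then 1 else 0) := by
    intro x y
    by_cases hx : x ∈ S <;> by_cases hy : y ∈ S
    · rw [hfg x, hfg y]; simp [hx, hy, min_add_add_right]
    · have : g y = 0 := by simp [hg, hy]
      rw [hfg x, hfg y, this]
      simp [hx, hy, hg0 x, add_nonneg (hg0 x) hc0.le]
    · have : g x = 0 := by simp [hg, hx]
      rw [hfg x, hfg y, this]
      simp [hx, hy, hg0 y, add_nonneg (hg0 y) hc0.le]
    · rw [hfg x, hfg y]; simp [hx, hy]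
  have hsumf : ∑ x, f x = ∑ x, g x + c * S.card := by
    rw [Finset.sum_congr rfl fun x _ => hfg x, Finset.sum_add_distrib, ← Finset.mul_sum]
    simp
  have hsumm : ∑ i, ∑ x, min (f x) (f (x + d i)) = ∑ i, ∑ x, min (g x) (g (x + d i)) +
      c * (∑ i, (S.filter fun x => x + d i ∈ S).card : ℕ) := by
    rw [Finset.sum_congr rfl fun i _ => Finset.sum_congr rfl fun x _ => hminfg x (x + d i)]
    simp_rw [Finset.sum_add_distrib, ← Finset.mul_sum]
    congr 2
    push_cast
    refine Finset.sum_congr rfl fun i _ => ?_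
    rw [Finset.sum_boole]
    congr 2
    ext x; simp
  rw [hsumf, hsumm]
  have h3 : c * (2 * (S.card * Real.log S.card)) ≤ c * (2 * (S.card * Real.log M)) :=
    mul_le_mul_of_nonneg_left (mul_le_mul_of_nonneg_left
      (mul_le_mul_of_nonneg_left hlog (Nat.cast_nonneg _)) zero_le_two) hc0.le
  have h4 := mul_le_mul_of_nonneg_left h2 hc0.le
  linarith

/-- Let `μ` be a measure of mass `1` on at most `M` points, and let each of the vectors `y` of a set
`Y` shift `μ` onto a measure that overlaps with the shift of `μ` by `y₀` in mass at least `1 / 2`.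
Then the differences `y - y₀` span a space of dimension at most `4 log₂ M`. -/
theorem finrank_span_mul_log_two_le [Finite F] [Fintype G] (M : ℕ) (μ : G → ℝ) (hμ : ∀ x, 0 ≤ μ x)
    (h1 : ∑ x, μ x = 1) (hM : (Finset.univ.filter fun x => μ x ≠ 0).card ≤ M) (Y : Set G) (y₀ : G)
    (hY : ∀ y ∈ Y, 1 / 2 ≤ ∑ x, min (μ (x - y)) (μ (x - y₀))) :
    Module.finrank F (Submodule.span F ((fun y => y - y₀) '' Y)) * Real.log 2 ≤
      4 * Real.log M := by
  classical
  set D : Set G := (fun y => y - y₀) '' Y with hD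
  obtain ⟨b, hbD, hspan, hli⟩ := exists_linearIndependent F D
  have : Fintype b := Fintype.ofFinite b
  have hli' : LinearIndepOn F id b := hli
  let B := Module.Basis.extend hli'
  have subset_ext : b ⊆ hli'.extend (Set.subset_univ _) := hli'.subset_extend _
  let l : b → G →ₗ[F] F := fun i => B.coord ⟨i, subset_ext i.2⟩
  have hl : ∀ i j : b, l i (j : G) = if i = j then 1 else 0 := by
    intro i j
    have : B ⟨j, subset_ext j.2⟩ = (j : G) := Module.Basis.extend_apply_self hli' _
    rw [← this]
    simp only [l, Module.Basis.coord_apply, Module.Basis.repr_self, Finsupp.single_apply,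
      Subtype.mk.injEq]
    simp only [Subtype.ext_iff, eq_comm]
  have key := sum_min_shift_le (fun i : b => (i : G)) l hl M μ hμ hM
  have hge : ∀ i : b, 1 / 2 ≤ ∑ x, min (μ x) (μ (x + (i : G))) := by
    intro i
    obtain ⟨y, hy, hyi⟩ := hbD i.2
    refine (hY y hy).trans (le_of_eq ?_)
    rw [← Equiv.sum_comp (Equiv.addRight y)]
    refine Finset.sum_congr rfl fun x _ => ?_
    simp only [Equiv.coe_addRight, add_sub_cancel_right]
    rw [← hyi]
    simp [add_sub_assoc]
  have hsum : (Fintype.card b : ℝ) * (1 / 2) ≤ ∑ i : b, ∑ x, min (μ x) (μ (x + (i : G))) := by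
    calc _ = ∑ i : b, (1 / 2 : ℝ) := by simp
      _ ≤ _ := Finset.sum_le_sum fun i _ => hge i
  have hrank : Module.finrank F (Submodule.span F D) = Fintype.card b := by
    rw [← hspan]
    have := finrank_span_eq_card hli
    rwa [Subtype.range_coe] at this
  rw [hrank]
  rw [h1, mul_one] at key
  have hl2 : 0 < Real.log 2 := Real.log_pos one_lt_two
  nlinarith [mul_le_mul_of_nonneg_right hsum hl2.le]

end Isoperimetry

/-! ### Entropy inequalities -/

theorem sq_le_one_add_mul_log_add {d : ℝ} (h0 : 0 ≤ d) (h1 : d < 1) :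
    d ^ 2 ≤ (1 + d) * Real.log (1 + d) + (1 - d) * Real.log (1 - d) := by
  set f : ℝ → ℝ := fun x => (1 + x) * Real.log (1 + x) + (1 - x) * Real.log (1 - x) - x ^ 2 with hf
  have hderiv : ∀ x ∈ Set.Ico (0 : ℝ) 1,
      HasDerivAt f (Real.log (1 + x) - Real.log (1 - x) - 2 * x) x := by
    intro x hx
    have hp : (1 + x) ≠ 0 := by linarith [hx.1]
    have hm : (1 - x) ≠ 0 := by linarith [hx.2]
    have e1 : HasDerivAt (fun y : ℝ => 1 + y) 1 x := (hasDerivAt_id x).const_add 1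
    have e2 : HasDerivAt (fun y : ℝ => 1 - y) (-1) x := (hasDerivAt_id x).const_sub 1
    have := ((e1.mul (e1.log hp)).add (e2.mul (e2.log hm))).sub (hasDerivAt_pow 2 x)
    refine this.congr_deriv ?_
    field_simp
    ring
  have hmono : MonotoneOn f (Set.Ico 0 1) := by
    refine monotoneOn_of_deriv_nonneg (convex_Ico 0 1)
      (fun x hx => (hderiv x hx).continuousAt.continuousWithinAt)
      (fun x hx => (hderiv x (interior_subset hx)).differentiableAt.differentiableWithinAt) ?_
    intro x hx
    have hx' := interior_subset hx
    rw [(hderiv x hx').deriv]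
    have hs := Real.hasSum_log_sub_log_of_abs_lt_one
      (show |x| < 1 by rw [abs_of_nonneg hx'.1]; exact hx'.2)
    have := sum_le_hasSum {0} (fun i _ => by have := hx'.1; positivity) hs
    simp at this
    linarith
  have := hmono (show (0 : ℝ) ∈ Set.Ico (0 : ℝ) 1 by simp)
    (show d ∈ Set.Ico (0 : ℝ) 1 from ⟨h0, h1⟩) h0
  simp [hf] at this
  linarith

open Real in
/-- Strong concavity of `x ↦ - x log x` at a midpoint. -/
theorem negMulLog_midpoint {a b : ℝ} (ha : 0 ≤ a) (hb : 0 ≤ b) :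
    negMulLog a + negMulLog b + (a - b) ^ 2 / (2 * (a + b)) ≤ 2 * negMulLog ((a + b) / 2) := by
  wlog hab : b ≤ a generalizing a b
  · have := this hb ha (le_of_not_ge hab)
    rw [add_comm b a] at this
    rw [show (a - b) ^ 2 = (b - a) ^ 2 by ring]
    linarith
  rcases ha.eq_or_lt with rfl | ha'
  · have : b = 0 := le_antisymm hab hb
    simp [this]
  rcases hb.eq_or_lt with rfl | hb'
  · have h2 : (1 : ℝ) / 2 ≤ log 2 := by linarith [Real.log_two_gt_d9]
    have h3 : (a - 0) ^ 2 / (2 * (a + 0)) = a * (1 / 2) := by field_simp; ring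
    rw [h3]
    simp only [negMulLog, add_zero, Real.log_div ha'.ne' two_ne_zero, Real.log_zero]
    nlinarith
  set m := (a + b) / 2 with hm
  have hm0 : 0 < m := by positivity
  set d := (a - b) / (a + b) with hd
  have hd0 : 0 ≤ d := div_nonneg (by linarith) (by linarith)
  have hd1 : d < 1 := by rw [hd, div_lt_one (by linarith)]; linarith
  have hA : a = m * (1 + d) := by rw [hm, hd]; field_simp; ring
  have hB : b = m * (1 - d) := by rw [hm, hd]; field_simp; ring
  have key := sq_le_one_add_mul_log_add hd0 hd1
  have hq : (a - b) ^ 2 / (2 * (a + b)) = m * d ^ 2 := by rw [hm, hd]; field_simp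
  rw [hq]
  have hla : log a = log m + log (1 + d) := by
    rw [← Real.log_mul hm0.ne' (by linarith), ← hA]
  have hlb : log b = log m + log (1 - d) := by
    rw [← Real.log_mul hm0.ne' (by linarith), ← hB]
  simp only [negMulLog, hla, hlb]
  have h5 := mul_le_mul_of_nonneg_left key hm0.le
  have : a + b = 2 * m := by rw [hm]; ring
  have e1 : -a * (log m + log (1 + d)) = -a * log m - m * ((1 + d) * log (1 + d)) := by
    linear_combination (-log (1 + d)) * hA
  have e2 : -b * (log m + log (1 - d)) = -b * log m - m * ((1 - d) * log (1 - d)) := by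
    linear_combination (-log (1 - d)) * hB
  have e3 : -a * log m + -b * log m = -2 * m * log m := by linear_combination (-log m) * this
  nlinarith

open Real in
/-- The change of entropy when a fraction `θ` of a mass `a` is removed in one place, and a fraction
`θ` of a mass `b` is added to a mass `a` in another place. -/
theorem negMulLog_exchange {a b θ : ℝ} (ha : 0 ≤ a) (hb : 0 ≤ b) (h0 : 0 < θ) (h1 : θ < 1) :
    2 * negMulLog a + θ * (negMulLog b - negMulLog a) + θ / 2 * ((a - b) ^ 2 / (a + b))
      - θ ^ 2 * (a + b) ≤ negMulLog ((1 - θ) * a) + negMulLog (a + θ * b) := by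
  have e1 : negMulLog ((1 - θ) * a) = (1 - θ) * negMulLog a + a * negMulLog (1 - θ) := by
    rw [Real.negMulLog_mul]; ring
  have e2 : θ * (1 - θ) ≤ negMulLog (1 - θ) := by
    have := Real.log_le_sub_one_of_pos (show 0 < 1 - θ by linarith)
    unfold negMulLog
    nlinarith
  set M := (a + θ * b) / (1 + θ) with hM
  have hM1 : a + θ * b = (1 + θ) * M := by rw [hM]; field_simp
  have e3 : negMulLog (a + θ * b) = (1 + θ) * negMulLog M + M * negMulLog (1 + θ) := by
    rw [hM1, Real.negMulLog_mul]; ring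
  have e4 : -(θ * (1 + θ)) ≤ negMulLog (1 + θ) := by
    have := Real.log_le_sub_one_of_pos (show 0 < 1 + θ by linarith)
    unfold negMulLog
    nlinarith
  have hM0 : 0 ≤ M := by positivity
  -- `M` is a convex combination of `a` and of the midpoint of `a` and `b`
  have e5 : (1 - θ) / (1 + θ) * negMulLog a + 2 * θ / (1 + θ) * negMulLog ((a + b) / 2) ≤
      negMulLog M := by
    have := Real.concaveOn_negMulLog.2 (show a ∈ Set.Ici 0 from ha)
      (show (a + b) / 2 ∈ Set.Ici 0 from by simp; linarith)
      (show 0 ≤ (1 - θ) / (1 + θ) from div_nonneg (by linarith) (by linarith))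
      (show 0 ≤ 2 * θ / (1 + θ) from by positivity) (by field_simp; ring)
    simp only [smul_eq_mul] at this
    have hMe : M = (1 - θ) / (1 + θ) * a + 2 * θ / (1 + θ) * ((a + b) / 2) := by
      rw [hM]; field_simp; ring
    rw [hMe]
    exact this
  have e6 : (1 - θ) * negMulLog a + 2 * θ * negMulLog ((a + b) / 2) ≤ (1 + θ) * negMulLog M := by
    have := mul_le_mul_of_nonneg_left e5 (show 0 ≤ 1 + θ by linarith)
    refine le_trans (le_of_eq ?_) this
    field_simp
  have e7 := negMulLog_midpoint ha hb
  have e8 : (a - b) ^ 2 / (2 * (a + b)) = 1 / 2 * ((a - b) ^ 2 / (a + b)) := by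
    rw [div_mul_div_comm, one_mul]
  rw [e8] at e7
  have e9 := mul_le_mul_of_nonneg_left e2 ha
  have e10 := mul_le_mul_of_nonneg_left e4 hM0
  have e11 := mul_le_mul_of_nonneg_left e7 h0.le
  rw [e1, e3]
  have e12 : M * -(θ * (1 + θ)) = -(θ * (a + θ * b)) := by rw [hM1]; ring
  nlinarith

/-- Cauchy–Schwarz for the triangular discrimination. -/
theorem sq_sum_abs_sub_le {X : Type} (S : Finset X) (A A' : X → ℝ) (hA : ∀ x, 0 ≤ A x)
    (hA' : ∀ x, 0 ≤ A' x) :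
    (∑ x ∈ S, |A x - A' x|) ^ 2 ≤
      (∑ x ∈ S, (A x - A' x) ^ 2 / (A x + A' x)) * ∑ x ∈ S, (A x + A' x) := by
  refine Finset.sum_sq_le_sum_mul_sum_of_sq_le_mul S
    (fun x _ => div_nonneg (sq_nonneg _) (add_nonneg (hA x) (hA' x)))
    (fun x _ => add_nonneg (hA x) (hA' x)) (fun x _ => le_of_eq ?_)
  rw [sq_abs]
  rcases (add_nonneg (hA x) (hA' x)).eq_or_lt with h | h
  · have h1 : A x = 0 := by linarith [hA x, hA' x]
    have h2 : A' x = 0 := by linarith [hA x, hA' x]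
    simp [h1, h2]
  · field_simp

open Real in
theorem negMulLog_le_tangent {x K : ℝ} (hx : 0 ≤ x) (hK : 0 < K) :
    negMulLog x ≤ x * (log K - 1) + 1 / K := by
  rcases hx.eq_or_lt with rfl | hx
  · simp; positivity
  have := Real.log_le_sub_one_of_pos (show 0 < 1 / (K * x) by positivity)
  rw [one_div, Real.log_inv, Real.log_mul hK.ne' hx.ne'] at this
  have h2 := mul_le_mul_of_nonneg_left this hx.le
  have h3 : x * ((K * x)⁻¹ - 1) = 1 / K - x := by field_simp
  rw [h3] at h2
  unfold negMulLog
  nlinarith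

open Real in
theorem negMulLog_le_near_one {x : ℝ} (hx : 0 ≤ x) :
    negMulLog x ≤ 1 - x - 1 / 2 * ((x - 1) ^ 2 / (x + 1)) := by
  have h1 := negMulLog_midpoint hx zero_le_one
  have h2 := negMulLog_le_tangent (show 0 ≤ (x + 1) / 2 by linarith) one_pos
  have h3 : (x - 1) ^ 2 / (2 * (x + 1)) = 1 / 2 * ((x - 1) ^ 2 / (x + 1)) := by
    rw [div_mul_div_comm, one_mul]
  simp at h2
  rw [h3, Real.negMulLog_one] at h1
  linarith

/-! ### Walkers on random words -/

/-- For every symbol `γ`, `m` moves `src γ i + γ = tgt γ i + next γ i` (the equation is imposed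
later): a walker at `γ` that meets the symbol `src γ i` may replace it by `tgt γ i` and walk on to
`next γ i`. The `2 m` symbols `src γ i`, `tgt γ i` are distinct. The position `none` stands for the
zero vector: a walker that has got there stays there. -/
structure ExchangeSystem (Γ : Type) (m : ℕ) where
  /-- the symbol that the move consumes -/
  src : Γ → Fin m → Γ
  /-- the symbol that the move emits -/
  tgt : Γ → Fin m → Γ
  /-- the new position of the walker -/
  next : Γ → Fin m → Option Γ
  inj : ∀ γ, Function.Injective (Sum.elim (src γ) (tgt γ))

/-- A word of `t` symbols, together with the position of a walker. -/
def Hist (Γ : Type) : ℕ → Type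
  | 0 => Option Γ
  | t + 1 => Γ × Hist Γ t

instance Hist.instFintype (Γ : Type) [Fintype Γ] : ∀ t, Fintype (Hist Γ t)
  | 0 => inferInstanceAs (Fintype (Option Γ))
  | t + 1 =>
    letI := Hist.instFintype Γ t
    inferInstanceAs (Fintype (Γ × Hist Γ t))

theorem Hist.card (Γ : Type) [Fintype Γ] (t : ℕ) :
    Fintype.card (Hist Γ t) = Fintype.card Γ ^ t * (Fintype.card Γ + 1) := by
  induction t with
  | zero => exact (Fintype.card_option).trans (by simp)
  | succ t ih =>
    refine (Fintype.card_prod Γ (Hist Γ t)).trans ?_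
    rw [ih]; ring

/-- The word `w x₁ … x_t` with the position of `x`. -/
def Hist.cons {Γ : Type} {t : ℕ} (w : Γ) (x : Hist Γ t) : Hist Γ (t + 1) := (w, x)

theorem Hist.sum_succ {Γ : Type} [Fintype Γ] {t : ℕ} {R : Type} [AddCommMonoid R]
    (f : Hist Γ (t + 1) → R) : ∑ x, f x = ∑ w : Γ, ∑ x : Hist Γ t, f (Hist.cons w x) :=
  Fintype.sum_prod_type f

namespace ExchangeSystem

variable {Γ : Type} [Fintype Γ] [DecidableEq Γ] {m : ℕ} (E : ExchangeSystem Γ m) (θ : ℝ)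

/-- The law of the emitted word and the final position of a walker that starts at `g`, reads a
uniformly random word, and makes each possible move with probability `θ`. It is given as a density
with respect to the uniform measure on words, so that its total mass is `|Γ| ^ t`. -/
def density : (t : ℕ) → Option Γ → Hist Γ t → ℝ
  | 0, g, x => if (show Option Γ from x) = g then 1 else 0
  | t + 1, none, x => density t none x.2
  | t + 1, some γ, x => density t (some γ) x.2 +
      θ * ((∑ i, if x.1 = E.tgt γ i then density t (E.next γ i) x.2 else 0) -
        ∑ i, if x.1 = E.src γ i then density t (some γ) x.2 else 0)

/-- Only the symbols `src γ i` and `tgt γ i` make a walker at `γ` behave in a special way. The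
function `K` is arbitrary, so that the lemma serves the mass, the law of the sum and the entropy. -/
theorem sum_density_succ {R : Type} [AddCommGroup R] (t : ℕ) (γ : Γ)
    (K : Γ → (Hist Γ t → ℝ) → R) :
    ∑ w, K w (fun x => E.density θ (t + 1) (some γ) (Hist.cons w x)) =
      ∑ w, K w (E.density θ t (some γ)) +
      ∑ i, ((K (E.src γ i) (fun x => (1 - θ) * E.density θ t (some γ) x) -
          K (E.src γ i) (E.density θ t (some γ))) +
        (K (E.tgt γ i) (fun x => E.density θ t (some γ) x + θ * E.density θ t (E.next γ i) x) -
          K (E.tgt γ i) (E.density θ t (some γ)))) := by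
  rw [← sub_eq_iff_eq_add', ← Finset.sum_sub_distrib, Finset.sum_add_distrib]
  refine Eq.trans ?_ (Fintype.sum_sum_type (Sum.elim
    (fun i => K (E.src γ i) (fun x => (1 - θ) * E.density θ t (some γ) x) -
        K (E.src γ i) (E.density θ t (some γ)))
    (fun i => K (E.tgt γ i)
        (fun x => E.density θ t (some γ) x + θ * E.density θ t (E.next γ i) x) -
        K (E.tgt γ i) (E.density θ t (some γ)))))
  symm
  refine Fintype.sum_of_injective _ (E.inj γ) _ _ ?_ ?_
  · intro w hw
    have h1 : ∀ i, w ≠ E.src γ i := fun i h => hw ⟨Sum.inl i, h.symm⟩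
    have h2 : ∀ i, w ≠ E.tgt γ i := fun i h => hw ⟨Sum.inr i, h.symm⟩
    simp [density, Hist.cons, h1, h2]
  · rintro (i | i)
    · have h1 : ∀ j, E.src γ i = E.src γ j ↔ i = j := fun j =>
        ⟨fun h => by simpa using E.inj γ (a₁ := Sum.inl i) (a₂ := Sum.inl j) h, fun h => by rw [h]⟩
      have h2 : ∀ j, E.src γ i ≠ E.tgt γ j := fun j h => by
        simpa using E.inj γ (a₁ := Sum.inl i) (a₂ := Sum.inr j) h
      simp only [Sum.elim_inl, density, Hist.cons, h1, h2]
      congr 2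
      funext x
      simp
      ring
    · have h1 : ∀ j, E.tgt γ i = E.tgt γ j ↔ i = j := fun j =>
        ⟨fun h => by simpa using E.inj γ (a₁ := Sum.inr i) (a₂ := Sum.inr j) h, fun h => by rw [h]⟩
      have h2 : ∀ j, E.tgt γ i ≠ E.src γ j := fun j h => by
        simpa using E.inj γ (a₁ := Sum.inr i) (a₂ := Sum.inl j) h
      simp only [Sum.elim_inr, density, Hist.cons, h1, h2]
      congr 2
      funext x
      simp

omit [Fintype Γ] in
theorem density_nonneg (h0 : 0 ≤ θ) (h1 : θ ≤ 1) :
    ∀ (t : ℕ) (g : Option Γ) (x : Hist Γ t), 0 ≤ E.density θ t g x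
  | 0, g, x => by simp only [density]; split_ifs <;> norm_num
  | t + 1, none, x => density_nonneg h0 h1 t none x.2
  | t + 1, some γ, (w, x) => by
    have ih := density_nonneg h0 h1 t
    simp only [density]
    have hs : (∑ i, if w = E.src γ i then E.density θ t (some γ) x else 0) ≤
        E.density θ t (some γ) x := by
      by_cases h : ∃ i, w = E.src γ i
      · obtain ⟨i, rfl⟩ := h
        have h1 : ∀ j, E.src γ i = E.src γ j ↔ i = j := fun j =>
          ⟨fun h => by simpa using E.inj γ (a₁ := Sum.inl i) (a₂ := Sum.inl j) h,
            fun h => by rw [h]⟩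
        simp [h1]
      · push Not at h
        simp [h, ih]
    have ht : 0 ≤ ∑ i, if w = E.tgt γ i then E.density θ t (E.next γ i) x else 0 :=
      Finset.sum_nonneg fun i _ => by split_ifs; exacts [ih _ _, le_rfl]
    nlinarith [ih (some γ) x]

omit [Fintype Γ] in
/-- The walker at `none` is deterministic: its density is an indicator function. -/
theorem density_none_sq (t : ℕ) (x : Hist Γ t) :
    E.density θ t none x = 0 ∨ E.density θ t none x = 1 := by
  induction t with
  | zero => simp only [density]; split_ifs <;> simp
  | succ t ih => exact ih x.2

theorem sum_density (t : ℕ) (g : Option Γ) :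
    ∑ x, E.density θ t g x = (Fintype.card Γ : ℝ) ^ t := by
  induction t generalizing g with
  | zero =>
    have : ∑ x : Option Γ, (if x = g then (1 : ℝ) else 0) = (Fintype.card Γ : ℝ) ^ 0 := by simp
    exact this
  | succ t ih =>
    rw [Hist.sum_succ]
    cases g with
    | none =>
      simp only [density, Hist.cons, ih, Finset.sum_const, Finset.card_univ, nsmul_eq_mul]
      ring
    | some γ =>
      rw [E.sum_density_succ θ t γ (fun _ A => ∑ x, A x)]
      simp only [Finset.sum_add_distrib, ← Finset.mul_sum, ih]
      simp only [Finset.sum_const, Finset.card_univ, nsmul_eq_mul]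
      ring

/-! ### The vectors represented by words and positions -/

section Push

variable {G : Type} [AddCommGroup G] [Fintype G] [DecidableEq G] (val : Γ → G)

/-- The vector of a position of the walker. -/
def posVal : Option Γ → G
  | none => 0
  | some γ => val γ

/-- The sum of the vectors of the symbols of a word and of the position of the walker. -/
def histVal : (t : ℕ) → Hist Γ t → G
  | 0, x => posVal val x
  | t + 1, x => val x.1 + histVal t x.2

/-- The number of words of length `t` with sum `y`. -/
def wordCount : ℕ → G → ℝ
  | 0, y => if y = 0 then 1 else 0
  | t + 1, y => ∑ w, wordCount t (y - val w)

omit [DecidableEq Γ] [Fintype G] in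
theorem wordCount_nonneg (t : ℕ) (y : G) : 0 ≤ wordCount val t y := by
  induction t generalizing y with
  | zero => simp only [wordCount]; split_ifs <;> norm_num
  | succ t ih => exact Finset.sum_nonneg fun w _ => ih _

omit [DecidableEq Γ] in
theorem sum_wordCount (t : ℕ) : ∑ y, wordCount val t y = (Fintype.card Γ : ℝ) ^ t := by
  induction t with
  | zero => simp [wordCount]
  | succ t ih =>
    simp only [wordCount]
    rw [Finset.sum_comm]
    have : ∀ w, ∑ y, wordCount val t (y - val w) = (Fintype.card Γ : ℝ) ^ t := fun w => by
      rw [← ih]; exact Equiv.sum_comp (Equiv.subRight (val w)) (wordCount val t)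
    simp [this, pow_succ, mul_comm]

omit [DecidableEq Γ] in
theorem card_wordCount_ne_zero_le (t : ℕ) :
    (Finset.univ.filter fun y => wordCount val t y ≠ 0).card ≤ Fintype.card Γ ^ t := by
  induction t with
  | zero => simp [wordCount, Finset.filter_eq']
  | succ t ih =>
    set S := Finset.univ.filter fun y => wordCount val t y ≠ 0
    have hsub : (Finset.univ.filter fun y => wordCount val (t + 1) y ≠ 0) ⊆
        Finset.univ.biUnion fun w : Γ => S.image fun z => z + val w := by
      intro y hy
      have hy' := (Finset.mem_filter.1 hy).2
      obtain ⟨w, _, hw⟩ := Finset.exists_ne_zero_of_sum_ne_zero hy'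
      simp only [Finset.mem_biUnion, Finset.mem_univ, true_and, Finset.mem_image]
      exact ⟨w, y - val w, by simp [S, hw], by abel⟩
    refine (Finset.card_le_card hsub).trans (Finset.card_biUnion_le.trans ?_)
    calc _ ≤ ∑ w : Γ, Fintype.card Γ ^ t :=
          Finset.sum_le_sum fun w _ => Finset.card_image_le.trans ih
      _ = _ := by simp [pow_succ, mul_comm]

variable (hval : ∀ γ i, val γ + val (E.src γ i) = val (E.tgt γ i) + posVal val (E.next γ i))
include hval

omit [Fintype G] in
/-- A walker that starts at `g` turns a random word into a word and a position whose total is the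
sum of the random word, shifted by the vector of `g`. -/
theorem sum_density_histVal (t : ℕ) (g : Option Γ) (y : G) :
    ∑ x, (if histVal val t x = y then E.density θ t g x else 0) =
      wordCount val t (y - posVal val g) := by
  induction t generalizing g y with
  | zero =>
    have : ∑ x : Option Γ, (if posVal val x = y then if x = g then (1 : ℝ) else 0 else 0) =
        if y - posVal val g = 0 then 1 else 0 := by
      rw [Finset.sum_eq_single g]
      · simp [sub_eq_zero, eq_comm]
      · intro b _ hb; simp [hb]
      · simp
    exact this
  | succ t ih =>
    rw [Hist.sum_succ]
    have hy : ∀ (w : Γ) (x : Hist Γ t),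
        histVal val (t + 1) (Hist.cons w x) = y ↔ histVal val t x = y - val w := fun w x => by
      simp only [histVal, Hist.cons]; exact eq_sub_iff_add_eq'.symm
    simp only [hy]
    cases g with
    | none =>
      simp only [density, Hist.cons, ih, wordCount, posVal, sub_zero]
    | some γ =>
      rw [E.sum_density_succ θ t γ
        (fun w A => ∑ x, if histVal val t x = y - val w then A x else 0)]
      simp only [ih]
      have h1 : ∀ z, ∑ x, (if histVal val t x = z then (1 - θ) * E.density θ t (some γ) x else 0) =
          (1 - θ) * wordCount val t (z - val γ) := fun z => by
        rw [← show posVal val (some γ) = val γ from rfl, ← ih (some γ) z, Finset.mul_sum]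
        exact Finset.sum_congr rfl fun x _ => by split_ifs <;> simp
      have h2 : ∀ z i, ∑ x, (if histVal val t x = z then E.density θ t (some γ) x +
            θ * E.density θ t (E.next γ i) x else 0) =
          wordCount val t (z - val γ) + θ * wordCount val t (z - posVal val (E.next γ i)) :=
        fun z i => by
        rw [← show posVal val (some γ) = val γ from rfl, ← ih (some γ) z, ← ih (E.next γ i) z,
          Finset.mul_sum, ← Finset.sum_add_distrib]
        exact Finset.sum_congr rfl fun x _ => by split_ifs <;> simp
      simp only [h1, h2]
      have h3 : ∀ i, y - val (E.src γ i) - val γ =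
          y - val (E.tgt γ i) - posVal val (E.next γ i) := fun i => by
        rw [sub_sub, sub_sub, add_comm (val (E.src γ i)), hval]
      have h4 : ∀ w, y - val w - val γ = y - val γ - val w := fun w => sub_right_comm _ _ _
      simp only [h3, posVal, wordCount, h4]
      rw [add_eq_left]
      refine Finset.sum_eq_zero fun i _ => ?_
      ring

/-- If the laws of the walkers from `g` and `g'` are close, the shifts of the law of a random sum by
the vectors of `g` and `g'` overlap. -/
theorem overlap_of_close (t : ℕ) (g g' : Option Γ)
    (h : ∑ x, |E.density θ t g x - E.density θ t g' x| ≤ (Fintype.card Γ : ℝ) ^ t) :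
    (Fintype.card Γ : ℝ) ^ t / 2 ≤
      ∑ y, min (wordCount val t (y - posVal val g)) (wordCount val t (y - posVal val g')) := by
  have h1 : ∑ x, min (E.density θ t g x) (E.density θ t g' x) ≤
      ∑ y, min (wordCount val t (y - posVal val g)) (wordCount val t (y - posVal val g')) := by
    calc _ = ∑ y, ∑ x, (if histVal val t x = y then
          min (E.density θ t g x) (E.density θ t g' x) else 0) := by
          rw [Finset.sum_comm]
          exact Finset.sum_congr rfl fun x _ => by simp
      _ ≤ _ := by
        refine Finset.sum_le_sum fun y _ => ?_
        rw [← E.sum_density_histVal θ val hval, ← E.sum_density_histVal θ val hval]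
        refine le_min (Finset.sum_le_sum fun x _ => ?_) (Finset.sum_le_sum fun x _ => ?_)
        · split_ifs; exacts [min_le_left _ _, le_rfl]
        · split_ifs; exacts [min_le_right _ _, le_rfl]
  refine le_trans ?_ h1
  have h2 : ∑ x, min (E.density θ t g x) (E.density θ t g' x) =
      (∑ x, E.density θ t g x + ∑ x, E.density θ t g' x -
        ∑ x, |E.density θ t g x - E.density θ t g' x|) / 2 := by
    rw [← Finset.sum_add_distrib, ← Finset.sum_sub_distrib, Finset.sum_div]
    refine Finset.sum_congr rfl fun x _ => ?_
    rw [min_def]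
    split_ifs with h
    · rw [abs_of_nonpos (by linarith)]; ring
    · rw [abs_of_nonneg (by linarith)]; ring
  rw [h2, sum_density, sum_density]
  linarith

end Push
end ExchangeSystem

/-! ### The entropy of a walker -/

namespace ExchangeSystem

variable {Γ : Type} [Fintype Γ] [DecidableEq Γ] {m : ℕ} (E : ExchangeSystem Γ m) (θ B : ℝ)

/-- The potential of a measure on words with positions: its entropy relative to the uniform measure
on words, with a bonus `B` for every unit of mass at the position `none`. -/
noncomputable def potential (t : ℕ) (A : Hist Γ t → ℝ) : ℝ :=
  ∑ x, Real.negMulLog (A x) + B * ∑ x, E.density θ t none x * A x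

/-- One step of the walk increases the potential of a walker at `γ` by the average difference to the
potentials of the walkers at `next γ i`, and by a term that measures how far the laws of these
walkers are apart, up to an error that is quadratic in `θ`. -/
theorem potential_succ_ge (h0 : 0 < θ) (h1 : θ < 1) (t : ℕ) (γ : Γ) :
    Fintype.card Γ * E.potential θ B t (E.density θ t (some γ)) +
      ∑ i, (θ * (E.potential θ B t (E.density θ t (E.next γ i)) -
          E.potential θ B t (E.density θ t (some γ))) +
        θ / 2 * (∑ x, (E.density θ t (some γ) x - E.density θ t (E.next γ i) x) ^ 2 /
          (E.density θ t (some γ) x + E.density θ t (E.next γ i) x)) -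
        2 * θ ^ 2 * (Fintype.card Γ : ℝ) ^ t) ≤
      E.potential θ B (t + 1) (E.density θ (t + 1) (some γ)) := by
  have hsplit : E.potential θ B (t + 1) (E.density θ (t + 1) (some γ)) =
      ∑ w, E.potential θ B t (fun x => E.density θ (t + 1) (some γ) (Hist.cons w x)) := by
    simp only [potential, Finset.sum_add_distrib, ← Finset.mul_sum]
    rw [Hist.sum_succ, Hist.sum_succ]
    rfl
  rw [hsplit, E.sum_density_succ θ t γ (fun _ A => E.potential θ B t A), Finset.sum_const,
    Finset.card_univ, nsmul_eq_mul]
  refine add_le_add le_rfl (Finset.sum_le_sum fun i _ => ?_)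
  set a := E.density θ t (some γ) with ha
  set b := E.density θ t (E.next γ i) with hb
  have ha0 : ∀ x, 0 ≤ a x := E.density_nonneg θ h0.le h1.le t _
  have hb0 : ∀ x, 0 ≤ b x := E.density_nonneg θ h0.le h1.le t _
  have hsa : ∑ x, a x = (Fintype.card Γ : ℝ) ^ t := E.sum_density θ t _
  have hsb : ∑ x, b x = (Fintype.card Γ : ℝ) ^ t := E.sum_density θ t _
  have key := Finset.sum_le_sum fun x (_ : x ∈ Finset.univ) =>
    negMulLog_exchange (ha0 x) (hb0 x) h0 h1
  simp only [Finset.sum_add_distrib, Finset.sum_sub_distrib, ← Finset.mul_sum, hsa, hsb] at key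
  simp only [potential, mul_add, mul_left_comm _ θ, mul_left_comm _ (1 - θ),
    Finset.sum_add_distrib, ← Finset.mul_sum]
  linarith

theorem potential_none (t : ℕ) :
    E.potential θ B t (E.density θ t none) = B * (Fintype.card Γ : ℝ) ^ t := by
  have h1 : ∀ x, Real.negMulLog (E.density θ t none x) = 0 := fun x => by
    rcases E.density_none_sq θ t x with h | h <;> simp [h]
  have h2 : ∀ x, E.density θ t none x * E.density θ t none x = E.density θ t none x := fun x => by
    rcases E.density_none_sq θ t x with h | h <;> simp [h]
  simp [potential, h1, h2, sum_density]

/-- A walker whose potential is almost maximal has almost surely ended up at `none`, with a word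
whose law is almost uniform. -/
theorem close_to_none (h0 : 0 < θ) (h1 : θ < 1) (t : ℕ) (g : Option Γ)
    (hB : B = Real.log (Fintype.card Γ) + 8) (hΓ : 0 < Fintype.card Γ)
    (h : (Fintype.card Γ : ℝ) ^ t * (B - 12 / 100) ≤ E.potential θ B t (E.density θ t g)) :
    ∑ x, |E.density θ t g x - E.density θ t none x| ≤ (Fintype.card Γ : ℝ) ^ t := by
  set N : ℝ := (Fintype.card Γ : ℝ) with hN
  have hN0 : 0 < N := by rw [hN]; exact_mod_cast hΓ
  set a := E.density θ t g with ha
  set d := E.density θ t none with hd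
  have ha0 : ∀ x, 0 ≤ a x := E.density_nonneg θ h0.le h1.le t _
  have hsa : ∑ x, a x = N ^ t := E.sum_density θ t _
  have hsd : ∑ x, d x = N ^ t := E.sum_density θ t _
  have hd01 : ∀ x, d x = 0 ∨ d x = 1 := E.density_none_sq θ t
  have hlog : Real.log (1000 * N) ≤ Real.log N + 7 := by
    rw [Real.log_mul (by norm_num) hN0.ne']
    have : Real.log 1000 ≤ 7 := by
      have h2 : Real.log 1000 ≤ Real.log (2 ^ 10) := Real.log_le_log (by norm_num) (by norm_num)
      rw [Real.log_pow] at h2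
      have := Real.log_two_lt_d9
      push_cast at h2
      linarith
    linarith
  -- `α` is the mass away from `none`, and `κ` measures how far the rest is from uniform
  set κ : ℝ := ∑ x, d x * ((a x - 1) ^ 2 / (a x + 1)) with hκ
  set α : ℝ := ∑ x, (1 - d x) * a x with hα
  have hdα : ∑ x, d x * a x = N ^ t - α := by
    rw [hα, ← hsa, ← Finset.sum_sub_distrib]
    exact Finset.sum_congr rfl fun x _ => by ring
  -- away from `none` there are `N ^ (t + 1)` points, where the entropy is at most about `log N` per
  -- unit of mass; the bonus `B = log N + 8` makes mass away from `none` too costly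
  have hpt : ∀ x, Real.negMulLog (a x) ≤ (1 - d x) * a x * (Real.log N + 6) +
      1 / (1000 * N) * (1 - d x) + (d x - d x * a x) -
        1 / 2 * (d x * ((a x - 1) ^ 2 / (a x + 1))) := by
    intro x
    rcases hd01 x with hx | hx
    · have h2 := negMulLog_le_tangent (ha0 x) (show 0 < 1000 * N by positivity)
      have h3 := mul_le_mul_of_nonneg_left hlog (ha0 x)
      simp only [hx]
      nlinarith
    · have h2 := negMulLog_le_near_one (ha0 x)
      simp only [hx]
      linarith
  have hcard : ∑ x : Hist Γ t, (1 - d x) = N ^ t * N := by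
    rw [Finset.sum_sub_distrib, hsd, Finset.sum_const, Finset.card_univ, Hist.card]
    simp [hN]; ring
  have hsum := Finset.sum_le_sum fun x (_ : x ∈ Finset.univ) => hpt x
  simp only [Finset.sum_add_distrib, Finset.sum_sub_distrib, ← Finset.mul_sum,
    ← Finset.sum_mul] at hsum
  rw [← Finset.sum_sub_distrib, hcard, hsd, hdα, ← hα, ← hκ] at hsum
  have hNt : 0 < N ^ t := by positivity
  have e1 : 1 / (1000 * N) * (N ^ t * N) = N ^ t / 1000 := by field_simp
  rw [e1] at hsum
  have hpot : E.potential θ B t a = ∑ x, Real.negMulLog (a x) + B * (N ^ t - α) := by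
    rw [potential, ← hdα]
  rw [hpot] at h
  have hακ : α + κ / 2 ≤ 121 / 1000 * N ^ t := by
    rw [hB] at h
    nlinarith
  have hα0 : 0 ≤ α := Finset.sum_nonneg fun x _ => by
    rcases hd01 x with hx | hx <;> simp [hx, ha0 x]
  have hκ0 : 0 ≤ κ := Finset.sum_nonneg fun x _ => by
    have := div_nonneg (sq_nonneg (a x - 1)) (add_nonneg (ha0 x) zero_le_one)
    rcases hd01 x with hx | hx <;> simp [hx, this]
  have hCS : (∑ x, d x * |a x - 1|) ^ 2 ≤ κ * ∑ x, d x * (a x + 1) := by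
    refine Finset.sum_sq_le_sum_mul_sum_of_sq_le_mul _ (fun x _ => ?_) (fun x _ => ?_)
      (fun x _ => le_of_eq ?_)
    · have := div_nonneg (sq_nonneg (a x - 1)) (add_nonneg (ha0 x) zero_le_one)
      rcases hd01 x with hx | hx <;> simp [hx, this]
    · have := add_nonneg (ha0 x) zero_le_one
      rcases hd01 x with hx | hx <;> simp [hx, this]
    · have : a x + 1 ≠ 0 := by linarith [ha0 x]
      rw [mul_pow, sq_abs]
      field_simp
  have e2 : ∑ x, d x * (a x + 1) = 2 * N ^ t - α := by
    simp only [mul_add, mul_one, Finset.sum_add_distrib, hdα, hsd]; ring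
  rw [e2] at hCS
  have e3 : ∑ x, d x * |a x - 1| ≤ 7 / 10 * N ^ t := by
    refine abs_le_of_sq_le_sq' (le_trans hCS ?_) (by positivity) |>.2
    nlinarith
  have e4 : ∑ x, |a x - d x| = α + ∑ x, d x * |a x - 1| := by
    rw [hα, ← Finset.sum_add_distrib]
    refine Finset.sum_congr rfl fun x _ => ?_
    rcases hd01 x with hx | hx
    · simp [hx, abs_of_nonneg (ha0 x)]
    · simp [hx]
  rw [e4]
  linarith

/-- The walk has a time `t` at which either every walker is close to one that starts at `none`, or
some walker is close to a quarter of the walkers at its neighbours `next γ i`. The set `alive`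
consists of the positions that can occur. The reason is that the least potential of a walker
increases from `0` to at most `B`, so that it has to increase slowly at some time, while
`potential_succ_ge` gives a quick increase if laws are far apart. -/
theorem exists_time_close (alive : Γ → Prop) (hnext : ∀ γ i γ', E.next γ i = some γ' → alive γ')
    (hm : 0 < m) (hmN : m ≤ Fintype.card Γ) (T : ℕ)
    (hT : Fintype.card Γ * (Real.log (Fintype.card Γ) + 8) ≤ T * (m * (1 / 100) ^ 2)) :
    ∃ t < T,
      (∀ γ, alive γ → ∑ x, |E.density (1 / 100) t (some γ) x - E.density (1 / 100) t none x| ≤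
        (Fintype.card Γ : ℝ) ^ t) ∨
      ∃ γ, alive γ ∧ ∃ I : Finset (Fin m), m ≤ 4 * I.card ∧ ∀ i ∈ I, E.next γ i ≠ none ∧
        ∑ x, |E.density (1 / 100) t (some γ) x - E.density (1 / 100) t (E.next γ i) x| ≤
          (Fintype.card Γ : ℝ) ^ t := by
  classical
  set θ : ℝ := 1 / 100 with hθ
  have h0 : 0 < θ := by norm_num [hθ]
  have h1 : θ < 1 := by norm_num [hθ]
  clear_value θ
  set N : ℝ := (Fintype.card Γ : ℝ) with hN
  have hΓ : 0 < Fintype.card Γ := hm.trans_le hmN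
  have hN1 : 1 ≤ N := by rw [hN]; exact_mod_cast hΓ
  have hN0 : 0 < N := by linarith
  set B : ℝ := Real.log N + 8 with hB
  have hB0 : 0 < B := by have := Real.log_nonneg hN1; linarith
  set S : Finset (Option Γ) := Finset.univ.filter fun g => ∀ γ, g = some γ → alive γ with hS
  have hnS : none ∈ S := by simp [hS]
  have hsS : ∀ γ, some γ ∈ S ↔ alive γ := by intro γ; simp [hS]
  have hnextS : ∀ γ i, E.next γ i ∈ S := by
    intro γ i; simp only [hS, Finset.mem_filter, Finset.mem_univ, true_and]; exact hnext γ i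
  -- the potential for probability measures, and its minimum over the possible starting points
  set Ψ : ℕ → Option Γ → ℝ := fun t g => E.potential θ B t (E.density θ t g) / N ^ t with hΨ
  set μ : ℕ → ℝ := fun t => S.inf' ⟨none, hnS⟩ (Ψ t) with hμ
  have hμle : ∀ t g, g ∈ S → μ t ≤ Ψ t g := fun t g hg => Finset.inf'_le _ hg
  have hNt : ∀ t, 0 < N ^ t := fun t => by positivity
  have hΨn : ∀ t, Ψ t none = B := fun t => by
    simp only [hΨ, potential_none]; rw [← hN]; field_simp
  have hμB : ∀ t, μ t ≤ B := fun t => hΨn t ▸ hμle t none hnS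
  have hμ0 : 0 ≤ μ 0 := by
    refine Finset.le_inf' _ _ fun g _ => ?_
    simp only [hΨ, pow_zero, div_one, potential]
    refine add_nonneg (Finset.sum_nonneg fun x _ => ?_) (mul_nonneg hB0.le
      (Finset.sum_nonneg fun x _ => mul_nonneg (E.density_nonneg θ h0.le h1.le _ _ _)
        (E.density_nonneg θ h0.le h1.le _ _ _)))
    simp only [density]
    split_ifs <;> simp
  -- a time at which the least potential increases slowly
  obtain ⟨t, htT, hslow⟩ : ∃ t < T, μ (t + 1) - μ t ≤ m * θ ^ 2 / N := by
    by_contra! hcon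
    have hstep : ∀ t ≤ T, t * (m * θ ^ 2 / N) ≤ μ t ∧ (0 < t → t * (m * θ ^ 2 / N) < μ t) := by
      intro t
      induction t with
      | zero => intro _; simpa using hμ0
      | succ t ih =>
        intro ht
        have h2 := (ih (by omega)).1
        have h3 := hcon t (by omega)
        have : ((t + 1 : ℕ) : ℝ) * (m * θ ^ 2 / N) < μ (t + 1) := by push_cast; linarith
        exact ⟨this.le, fun _ => this⟩
    have hTpos : 0 < T := by
      rcases Nat.eq_zero_or_pos T with h | h
      · rw [h] at hT
        simp only [Nat.cast_zero, zero_mul] at hT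
        nlinarith
      · exact h
    have h2 := (hstep T le_rfl).2 hTpos
    have h3 := hμB T
    have h4 : B ≤ T * (m * θ ^ 2 / N) := by
      rw [← mul_div_assoc, le_div_iff₀ hN0]; linarith
    linarith
  have hmR : (0 : ℝ) < m := by exact_mod_cast hm
  have hmNR : (m : ℝ) ≤ N := by rw [hN]; exact_mod_cast hmN
  -- if the least potential is almost `B`, all walkers are close to the one from `none`
  have hfin : B - 12 / 100 ≤ μ t → ∃ t < T,
      (∀ γ, alive γ → ∑ x, |E.density θ t (some γ) x - E.density θ t none x| ≤ N ^ t) ∨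
      ∃ γ, alive γ ∧ ∃ I : Finset (Fin m), m ≤ 4 * I.card ∧ ∀ i ∈ I, E.next γ i ≠ none ∧
        ∑ x, |E.density θ t (some γ) x - E.density θ t (E.next γ i) x| ≤ N ^ t := by
    intro hb
    refine ⟨t, htT, Or.inl fun γ hγ => ?_⟩
    refine E.close_to_none θ B h0 h1 t (some γ) hB hΓ ?_
    have h2 := hb.trans (hμle t _ ((hsS γ).2 hγ))
    rw [hΨ, le_div_iff₀ (hNt t)] at h2
    linarith
  obtain ⟨g, hgS, hg⟩ := Finset.exists_mem_eq_inf' ⟨none, hnS⟩ (Ψ (t + 1))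
  have hg' : μ (t + 1) = Ψ (t + 1) g := hg
  cases g with
  | none =>
    apply hfin
    rw [hg', hΨn] at hslow
    have : m * θ ^ 2 / N ≤ θ ^ 2 := by
      rw [div_le_iff₀ hN0]; nlinarith [sq_nonneg θ]
    have : θ ^ 2 ≤ 12 / 100 := by norm_num [hθ]
    linarith
  | some γ =>
    have hγ : alive γ := (hsS γ).1 hgS
    set f : Fin m → ℝ := fun i =>
      (∑ x, |E.density θ t (some γ) x - E.density θ t (E.next γ i) x|) / N ^ t with hf
    have hf2 : ∀ i, f i ^ 2 / 2 ≤
        (∑ x, (E.density θ t (some γ) x - E.density θ t (E.next γ i) x) ^ 2 /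
          (E.density θ t (some γ) x + E.density θ t (E.next γ i) x)) / N ^ t := by
      intro i
      have h2 := sq_sum_abs_sub_le Finset.univ (E.density θ t (some γ))
        (E.density θ t (E.next γ i)) (E.density_nonneg θ h0.le h1.le _ _)
        (E.density_nonneg θ h0.le h1.le _ _)
      rw [Finset.sum_add_distrib, sum_density, sum_density, ← hN] at h2
      simp only [hf]
      rw [div_pow, div_div, div_le_div_iff₀ (by positivity) (hNt t)]
      nlinarith [hNt t]
    have hrec := E.potential_succ_ge θ B h0 h1 t γ
    rw [← hN] at hrec
    have hrec2 : N * Ψ t (some γ) + ∑ i, (θ * (Ψ t (E.next γ i) - Ψ t (some γ)) +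
        θ * (f i ^ 2 / 4) - 2 * θ ^ 2) ≤ N * Ψ (t + 1) (some γ) := by
      have h2 : N * Ψ (t + 1) (some γ) =
          E.potential θ B (t + 1) (E.density θ (t + 1) (some γ)) / N ^ t := by
        simp only [hΨ, pow_succ]; field_simp
      rw [h2]
      refine le_trans ?_ (div_le_div_of_nonneg_right hrec (hNt t).le)
      rw [add_div, Finset.sum_div, mul_div_assoc]
      refine add_le_add le_rfl (Finset.sum_le_sum fun i _ => ?_)
      have h3 := mul_le_mul_of_nonneg_left (hf2 i) (show 0 ≤ θ / 2 by positivity)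
      have h4 : ∀ P Q X : ℝ, (θ * (P - Q) + θ / 2 * X - 2 * θ ^ 2 * N ^ t) / N ^ t =
          θ * (P / N ^ t - Q / N ^ t) + θ / 2 * (X / N ^ t) - 2 * θ ^ 2 := fun P Q X => by
        field_simp
      rw [h4]
      simp only [hΨ]
      linarith
    -- the start `γ` of least potential at time `t + 1` gains little, so that its neighbours have
    -- almost minimal potential and laws close to its own, on average
    have hsum : ∑ i, ((Ψ t (E.next γ i) - μ t) + f i ^ 2 / 4) ≤ 3 * m * θ := by
      rw [← hg'] at hrec2
      have h2 : N * (μ (t + 1) - μ t) ≤ m * θ ^ 2 := by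
        have := mul_le_mul_of_nonneg_left hslow hN0.le
        rwa [mul_div_cancel₀ _ hN0.ne'] at this
      have h3 : ∑ i, (θ * (Ψ t (E.next γ i) - Ψ t (some γ)) + θ * (f i ^ 2 / 4) - 2 * θ ^ 2) =
          θ * ∑ i, ((Ψ t (E.next γ i) - μ t) + f i ^ 2 / 4) -
            m * (θ * (Ψ t (some γ) - μ t)) - m * (2 * θ ^ 2) := by
        have : ∀ i, θ * (Ψ t (E.next γ i) - Ψ t (some γ)) + θ * (f i ^ 2 / 4) - 2 * θ ^ 2 =
            θ * ((Ψ t (E.next γ i) - μ t) + f i ^ 2 / 4) - (θ * (Ψ t (some γ) - μ t)) -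
              (2 * θ ^ 2) := fun i => by ring
        rw [Finset.sum_congr rfl fun i _ => this i]
        rw [Finset.sum_sub_distrib, Finset.sum_sub_distrib, ← Finset.mul_sum]
        simp
      rw [h3] at hrec2
      have h4 : 0 ≤ Ψ t (some γ) - μ t := sub_nonneg.2 (hμle t _ hgS)
      have h5 : 0 ≤ (N - m * θ) * (Ψ t (some γ) - μ t) :=
        mul_nonneg (sub_nonneg.2 ((mul_le_of_le_one_right hmR.le h1.le).trans hmNR)) h4
      have h6 : θ * ∑ i, ((Ψ t (E.next γ i) - μ t) + f i ^ 2 / 4) ≤ θ * (3 * m * θ) := by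
        nlinarith
      exact le_of_mul_le_mul_left h6 h0
    have hterm : ∀ i, 0 ≤ Ψ t (E.next γ i) - μ t := fun i =>
      sub_nonneg.2 (hμle t _ (hnextS γ i))
    set I₀ := Finset.univ.filter fun i => E.next γ i = none with hI₀
    set I₁ := Finset.univ.filter fun i => E.next γ i ≠ none ∧ f i ≤ 1 with hI₁
    set I₂ := Finset.univ.filter fun i => 1 < f i with hI₂
    have hcover : m ≤ I₀.card + I₁.card + I₂.card := by
      have : (Finset.univ : Finset (Fin m)) ⊆ (I₀ ∪ I₁) ∪ I₂ := by
        intro i _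
        simp only [hI₀, hI₁, hI₂, Finset.mem_union, Finset.mem_filter, Finset.mem_univ, true_and]
        by_cases h : E.next γ i = none
        · exact Or.inl (Or.inl h)
        · rcases le_or_gt (f i) 1 with h' | h'
          · exact Or.inl (Or.inr ⟨h, h'⟩)
          · exact Or.inr h'
      have h2 := Finset.card_le_card this
      rw [Finset.card_univ, Fintype.card_fin] at h2
      have h3 := Finset.card_union_le (I₀ ∪ I₁) I₂
      have h4 := Finset.card_union_le I₀ I₁
      omega
    have hI₂c : (I₂.card : ℝ) * (1 / 4) ≤ 3 * m * θ := by
      refine le_trans ?_ hsum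
      rw [← nsmul_eq_mul]
      refine (Finset.card_nsmul_le_sum I₂ (fun i => (Ψ t (E.next γ i) - μ t) + f i ^ 2 / 4) _
        fun i hi => ?_).trans
        (Finset.sum_le_sum_of_subset_of_nonneg (Finset.subset_univ _) fun i _ _ =>
          add_nonneg (hterm i) (by positivity))
      have : 1 < f i := (Finset.mem_filter.1 hi).2
      have := hterm i
      nlinarith
    have hI₀c : (I₀.card : ℝ) * (B - μ t) ≤ 3 * m * θ := by
      refine le_trans ?_ hsum
      rw [← nsmul_eq_mul]
      refine (Finset.card_nsmul_le_sum I₀ (fun i => (Ψ t (E.next γ i) - μ t) + f i ^ 2 / 4) _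
        fun i hi => ?_).trans
        (Finset.sum_le_sum_of_subset_of_nonneg (Finset.subset_univ _) fun i _ _ =>
          add_nonneg (hterm i) (by positivity))
      have h2 : E.next γ i = none := (Finset.mem_filter.1 hi).2
      rw [h2, hΨn]
      have : 0 ≤ f i ^ 2 := sq_nonneg _
      linarith
    by_cases hcase : m ≤ 4 * I₁.card
    · refine ⟨t, htT, Or.inr ⟨γ, hγ, I₁, hcase, fun i hi => ?_⟩⟩
      have h2 := (Finset.mem_filter.1 hi).2
      refine ⟨h2.1, ?_⟩
      have h3 := h2.2
      simp only [hf] at h3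
      rwa [div_le_one (hNt t)] at h3
    · apply hfin
      push Not at hcase
      have h2 : (m : ℝ) ≤ I₀.card + I₁.card + I₂.card := by exact_mod_cast hcover
      have h3 : 4 * (I₁.card : ℝ) ≤ m := by exact_mod_cast hcase.le
      have h4 : (m : ℝ) / 2 ≤ I₀.card := by
        rw [hθ] at hI₂c; linarith
      have h5 : 0 ≤ B - μ t := sub_nonneg.2 (hμB t)
      have h6 : (m : ℝ) / 2 * (B - μ t) ≤ 3 * m * θ :=
        (mul_le_mul_of_nonneg_right h4 h5).trans hI₀c
      have h7 : (m : ℝ) * (B - μ t) ≤ m * (6 * θ) := by linarith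
      have h8 := le_of_mul_le_mul_left h7 hmR
      rw [hθ] at h8
      linarith

end ExchangeSystem

/-! ### Walkers on spanning triples and the dimension bound -/

section Dimension

variable {F : Type} [Field F] {G : Type} [AddCommGroup G] [Module F G] {n m : ℕ}

/-- The vector `c • a v` of the symbol `(v, c)`. -/
def symbolVal (a : Fin n → G) (γ : Fin n × F) : G := γ.2 • a γ.1

open Classical in
/-- The moves given by disjoint triples: if `a v = c₀ a p₀ + c₁ a p₁ + c₂ a p₂` then a walker at
`c • a v` absorbs the symbol `- c c₀ • a p₀`, emits `c c₁ • a p₁` and walks on to `c c₂ • a p₂`. -/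
noncomputable def tripleSystem (a : Fin n → G) (p : Fin n → Fin m × Fin 3 → Fin n)
    (hp : ∀ v, Function.Injective (p v)) (c : Fin n → Fin m → Fin 3 → F) :
    ExchangeSystem (Fin n × F) m where
  src γ i := (p γ.1 (i, 0), -(γ.2 * c γ.1 i 0))
  tgt γ i := (p γ.1 (i, 1), γ.2 * c γ.1 i 1)
  next γ i := if symbolVal a (p γ.1 (i, 2), γ.2 * c γ.1 i 2) = 0 then none
    else some (p γ.1 (i, 2), γ.2 * c γ.1 i 2)
  inj γ := by
    rintro (i | i) (j | j) h <;> simp only [Sum.elim_inl, Sum.elim_inr, Prod.mk.injEq] at h <;>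
      have := hp γ.1 h.1 <;> simp_all

variable [Fintype F] [Finite G]

/-- One round of the argument: either the vectors `a v` span a space of small dimension, or a
subspace of small dimension contains many nonzero vectors `a v`. -/
theorem finrank_le_or_exists_submodule (a : Fin n → G) (hm : 0 < m)
    (H : ∀ v, HasDisjointTriples F a m v) (hmN : m ≤ n * Fintype.card F) (T : ℕ)
    (hT : (n * Fintype.card F : ℝ) * (Real.log (n * Fintype.card F) + 8) ≤
      T * (m * (1 / 100) ^ 2)) :
    Module.finrank F (Submodule.span F (Set.range a)) * Real.log 2 ≤
      4 * (T * Real.log (n * Fintype.card F)) ∨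
    ∃ Y : Submodule F G, (Module.finrank F Y - 1) * Real.log 2 ≤
        4 * (T * Real.log (n * Fintype.card F)) ∧
      ∃ S : Finset (Fin n), m ≤ 4 * S.card ∧ ∀ v ∈ S, a v ≠ 0 ∧ a v ∈ Y := by
  classical
  have : Fintype G := Fintype.ofFinite G
  choose p c hp hc using H
  set E := tripleSystem a p hp c with hE
  have hval : ∀ γ i, symbolVal a γ + symbolVal a (E.src γ i) =
      symbolVal a (E.tgt γ i) + ExchangeSystem.posVal (symbolVal a) (E.next γ i) := by
    intro γ i
    have h1 : ExchangeSystem.posVal (symbolVal a) (E.next γ i) =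
        (γ.2 * c γ.1 i 2) • a (p γ.1 (i, 2)) := by
      simp only [hE, tripleSystem]
      split_ifs with h
      · exact h.symm
      · rfl
    rw [h1]
    simp only [hE, tripleSystem, symbolVal]
    rw [hc γ.1 i, Fin.sum_univ_three, smul_add, smul_add, smul_smul, smul_smul, smul_smul, neg_smul]
    abel
  have hcard : Fintype.card (Fin n × F) = n * Fintype.card F := by simp
  have hcardR : (Fintype.card (Fin n × F) : ℝ) = n * Fintype.card F := by rw [hcard]; push_cast; rfl
  have hN : 1 ≤ (n * Fintype.card F : ℝ) := by exact_mod_cast (hm.trans_le hmN)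
  have hl2 : 0 < Real.log 2 := Real.log_pos one_lt_two
  -- closeness of walkers bounds the dimension of differences
  have hdim : ∀ t < T, ∀ (P : Set (Option (Fin n × F))) (g₀ : Option (Fin n × F)),
      (∀ g ∈ P, ∑ x, |E.density (1 / 100) t g₀ x - E.density (1 / 100) t g x| ≤
        (Fintype.card (Fin n × F) : ℝ) ^ t) →
      Module.finrank F (Submodule.span F ((fun g => ExchangeSystem.posVal (symbolVal a) g -
        ExchangeSystem.posVal (symbolVal a) g₀) '' P)) * Real.log 2 ≤
      4 * (T * Real.log (n * Fintype.card F)) := by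
    intro t ht P g₀ hP
    have hNt : 0 < (Fintype.card (Fin n × F) : ℝ) ^ t := by
      rw [hcardR]; exact pow_pos (by linarith) _
    have key := finrank_span_mul_log_two_le (F := F) (Fintype.card (Fin n × F) ^ t)
      (fun y => ExchangeSystem.wordCount (symbolVal a) t y / (Fintype.card (Fin n × F) : ℝ) ^ t)
      (fun y => div_nonneg (ExchangeSystem.wordCount_nonneg _ t y) hNt.le)
      (by rw [← Finset.sum_div, ExchangeSystem.sum_wordCount (symbolVal (F := F) a) t,
        div_self hNt.ne'])
      (by
        refine le_trans (Finset.card_le_card fun y hy => ?_)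
          (ExchangeSystem.card_wordCount_ne_zero_le (symbolVal a) t)
        simp only [Finset.mem_filter, Finset.mem_univ, true_and] at hy ⊢
        exact fun h => hy (by rw [h, zero_div]))
      (ExchangeSystem.posVal (symbolVal a) '' P) (ExchangeSystem.posVal (symbolVal a) g₀)
      (by
        rintro _ ⟨g, hg, rfl⟩
        have h1 := E.overlap_of_close (1 / 100) (symbolVal a) hval t g₀ g (hP g hg)
        rw [Finset.sum_congr rfl fun y _ => min_div_div_right hNt.le _ _, ← Finset.sum_div,
          le_div_iff₀ hNt]
        refine (le_of_eq (by ring)).trans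
          (h1.trans (le_of_eq (Finset.sum_congr rfl fun y _ => min_comm _ _))))
    rw [Set.image_image] at key
    refine key.trans ?_
    push_cast
    rw [Real.log_pow]
    have h2 : (t : ℝ) ≤ T := by exact_mod_cast ht.le
    have h3 := Real.log_nonneg hN
    have h4 : Real.log (n * Fintype.card F) =
        Real.log ((Fintype.card (Fin n) * Fintype.card F)) := by
      simp
    simp only [Fintype.card_prod, Fintype.card_fin] at *
    push_cast at *
    gcongr
  obtain ⟨t, ht, h | ⟨γ, hγ, I, hI, h⟩⟩ := E.exists_time_close (fun γ => symbolVal a γ ≠ 0)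
    (by
      intro γ i γ' h
      simp only [hE, tripleSystem] at h
      split_ifs at h with h0
      rw [Option.some.injEq] at h
      rwa [← h]) hm (hcard ▸ hmN) T (by rw [hcardR]; exact hT)
  · left
    have h1 := hdim t ht (some '' {γ | symbolVal a γ ≠ 0}) none (by
      rintro _ ⟨γ, hγ, rfl⟩
      have := h γ hγ
      simpa only [abs_sub_comm] using this)
    refine le_trans ?_ h1
    gcongr
    have : Module.Finite F G := Module.Finite.of_finite
    refine Submodule.finrank_mono (Submodule.span_le.2 ?_)
    rintro _ ⟨v, rfl⟩
    by_cases hv : a v = 0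
    · rw [hv]; exact Submodule.zero_mem _
    · refine Submodule.subset_span ⟨some (v, 1), ⟨(v, 1), ?_, rfl⟩, ?_⟩ <;>
        simp [symbolVal, ExchangeSystem.posVal, hv]
  · right
    have : Module.Finite F G := Module.Finite.of_finite
    set W := Submodule.span F ((fun g => ExchangeSystem.posVal (symbolVal a) g -
        ExchangeSystem.posVal (symbolVal a) (some γ)) '' (E.next γ '' I)) with hW
    have h1 := hdim t ht (E.next γ '' I) (some γ) (by
      rintro _ ⟨i, hi, rfl⟩
      exact (h i hi).2)
    refine ⟨W ⊔ Submodule.span F {symbolVal a γ}, ?_, I.image fun i => p γ.1 (i, 2), ?_, ?_⟩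
    · refine le_trans ?_ h1
      gcongr
      have h2 := Submodule.finrank_add_le_finrank_add_finrank W (Submodule.span F {symbolVal a γ})
      have h3 : Module.finrank F (Submodule.span F {symbolVal a γ}) ≤ 1 :=
        (finrank_span_le_card ({symbolVal a γ} : Set G)).trans (by simp)
      have h4 : Module.finrank F ↥(W ⊔ Submodule.span F {symbolVal a γ}) ≤
        Module.finrank F W + 1 := by omega
      have h5 : (Module.finrank F ↥(W ⊔ Submodule.span F {symbolVal a γ}) : ℝ) ≤
        Module.finrank F W + 1 := by exact_mod_cast h4
      linarith
    · rw [Finset.card_image_of_injective]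
      · exact hI
      · intro i j hij
        simpa using hp γ.1 hij
    · intro v hv
      obtain ⟨i, hi, rfl⟩ := Finset.mem_image.1 hv
      have h2 := (h i hi).1
      have h3 : E.next γ i = some (p γ.1 (i, 2), γ.2 * c γ.1 i 2) := by
        simp only [hE, tripleSystem] at h2 ⊢
        split_ifs at h2 ⊢ with h0
        · exact absurd rfl h2
        · rfl
      have h4 : symbolVal a (p γ.1 (i, 2), γ.2 * c γ.1 i 2) ≠ 0 := by
        intro h0
        apply h2
        simp only [hE, tripleSystem, if_pos h0]
      have h5 : γ.2 * c γ.1 i 2 ≠ 0 := by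
        intro h0; apply h4; simp [symbolVal, h0]
      refine ⟨fun h0 => h4 (by simp [symbolVal, h0]), ?_⟩
      have h6 : symbolVal a (p γ.1 (i, 2), γ.2 * c γ.1 i 2) ∈
          W ⊔ Submodule.span F {symbolVal a γ} := by
        have h7 : symbolVal a (p γ.1 (i, 2), γ.2 * c γ.1 i 2) - symbolVal a γ ∈ W := by
          refine Submodule.subset_span ⟨E.next γ i, ⟨i, hi, rfl⟩, ?_⟩
          rw [h3]; rfl
        have h8 := Submodule.add_mem_sup h7 (Submodule.mem_span_singleton_self (R := F)
          (symbolVal a γ))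
        rwa [sub_add_cancel] at h8
      have h9 := Submodule.smul_mem _ (γ.2 * c γ.1 i 2)⁻¹ h6
      simp only [symbolVal, smul_smul] at h9
      rwa [inv_mul_cancel₀ h5, one_smul] at h9

end Dimension

/-- Quotients by the subspaces of `finrank_le_or_exists_submodule` leave fewer and fewer nonzero
vectors, so that few rounds exhaust the space. -/
theorem finrank_mul_le {F : Type} [Field F] [Fintype F] {n m : ℕ} (hm : 0 < m)
    (hmN : m ≤ n * Fintype.card F) (T : ℕ)
    (hT : (n * Fintype.card F : ℝ) * (Real.log (n * Fintype.card F) + 8) ≤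
      T * (m * (1 / 100) ^ 2)) (s : ℕ) :
    ∀ (G : Type) [AddCommGroup G] [Module F G] [Finite G] (a : Fin n → G),
      Submodule.span F (Set.range a) = ⊤ → (∀ v, HasDisjointTriples F a m v) →
      ∀ A : Finset (Fin n), (∀ v, a v ≠ 0 → v ∈ A) → A.card ≤ s →
      Module.finrank F G * m * Real.log 2 ≤
        (4 * s + m) * (4 * (T * Real.log (n * Fintype.card F)) + Real.log 2) := by
  classical
  have hN : 1 ≤ (n * Fintype.card F : ℝ) := by exact_mod_cast (hm.trans_le hmN)
  set D := 4 * (T * Real.log (n * Fintype.card F)) with hD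
  have hD0 : 0 ≤ D := by have := Real.log_nonneg hN; positivity
  have hl2 : 0 < Real.log 2 := Real.log_pos one_lt_two
  have hmR : (0 : ℝ) < m := by exact_mod_cast hm
  induction s using Nat.strong_induction_on with
  | _ s ih =>
  intro G _ _ _ a hspan H A hA hAs
  have : Module.Finite F G := Module.Finite.of_finite
  rcases finrank_le_or_exists_submodule a hm H hmN T hT with h | ⟨Y, hY, S, hS, hSY⟩
  · rw [hspan, finrank_top] at h
    have h2 := mul_le_mul_of_nonneg_left h hmR.le
    have h3 : 0 ≤ (s : ℝ) * (D + Real.log 2) := by positivity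
    nlinarith
  · have hSA : S ⊆ A := fun v hv => hA v (hSY v hv).1
    have hcard : (A \ S).card + S.card ≤ s := by
      rw [Finset.card_sdiff_add_card_eq_card hSA]; exact hAs
    have hSpos : 0 < S.card := by omega
    have : Finite (G ⧸ Y) := Finite.of_surjective Y.mkQ Y.mkQ_surjective
    have hle := ih (s - S.card) (by omega) (G ⧸ Y) (Y.mkQ ∘ a)
      (by rw [Set.range_comp, Submodule.span_image, hspan, Submodule.map_top, Submodule.range_mkQ])
      (fun v => (H v).map Y.mkQ) (A \ S) (by
        intro v hv
        rw [Finset.mem_sdiff]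
        refine ⟨hA v fun h0 => hv (by simp [h0]), fun hvS => hv ?_⟩
        exact (Submodule.Quotient.mk_eq_zero Y).2 (hSY v hvS).2) (by omega)
    have hrank := Submodule.finrank_quotient_add_finrank Y
    rw [← hrank]
    rw [Nat.cast_sub (by omega)] at hle
    have h4 : (m : ℝ) ≤ 4 * S.card := by exact_mod_cast hS
    have h5 : (m : ℝ) * (D + Real.log 2) ≤ 4 * S.card * (D + Real.log 2) := by gcongr
    have h6 := mul_le_mul_of_nonneg_left hY hmR.le
    push_cast
    nlinarith

/-! ### Exponential length of linear 3-query locally correctable codes -/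

theorem span_range_codeRow {F : Type} [Field F] {k n : ℕ} (L : (Fin k → F) →ₗ[F] (Fin n → F))
    (hL : Function.Injective L) : Submodule.span F (Set.range (codeRow L)) = ⊤ := by
  rw [eq_top_iff]
  intro K _
  refine mem_span_of_iInf_ker_le_ker fun x hx => ?_
  rw [Submodule.mem_iInf] at hx
  have : L x = L 0 := by
    rw [map_zero]; funext v; exact hx v
  rw [hL this]; exact Submodule.zero_mem _

theorem IsLCC.mono {F : Type} [DecidableEq F] {k n q : ℕ} {δ δ' ε : ℝ} (hδ : δ' ≤ δ)
    {L : (Fin k → F) → (Fin n → F)} (h : IsLCC q δ ε L) : IsLCC q δ' ε L := by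
  obtain ⟨Dec, h1, h2⟩ := h
  exact ⟨Dec, h1, fun b u y hy => h2 b u y (hy.trans (by gcongr))⟩

/-- If all symbols could be corrupted, every coordinate would be a combination of no coordinates. -/
theorem IsLCC.lt_one {F : Type} [Field F] [Fintype F] [DecidableEq F] {k n q : ℕ} {δ ε : ℝ}
    {L : (Fin k → F) →ₗ[F] (Fin n → F)} (hL : Function.Injective L) (hk : 0 < k) (hε : 0 < ε)
    (h : IsLCC q δ ε L) : δ < 1 := by
  by_contra! hδ
  have h0 : ∀ u, codeRow L u = 0 := by
    intro u
    obtain ⟨C, -, hC, hspan⟩ := h.exists_span hε u Finset.univ (by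
      simp only [Finset.card_univ, Fintype.card_fin]
      nlinarith [Nat.cast_nonneg (α := ℝ) n])
    have : C = ∅ := Finset.eq_empty_of_forall_notMem fun v hv =>
      Finset.disjoint_left.1 hC hv (Finset.mem_univ v)
    simpa [this] using hspan
  have h1 : L (Pi.single ⟨0, hk⟩ 1) = L 0 := by
    rw [map_zero]; funext v
    exact congrArg (fun f : (Fin k → F) →ₗ[F] F => f (Pi.single ⟨0, hk⟩ 1)) (h0 v)
  have := congrFun (hL h1) ⟨0, hk⟩
  simp at this

/-- The bound `k = O(δ⁻² |F| log² n)` on the dimension, which is stronger than the exponent `1 / 8`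
requires. -/
theorem IsLCC.sq_mul_le {F : Type} [Field F] [Fintype F] [DecidableEq F] {k n : ℕ}
    {L : (Fin k → F) →ₗ[F] (Fin n → F)} {δ ε : ℝ} (hn : 6 ≤ n) (hL : Function.Injective L)
    (hδ : 0 < δ) (hδ2 : δ ≤ 1 / 2) (hε : 0 < ε) (h : IsLCC 3 δ ε L) (hF : Fintype.card F ≤ n) :
    δ ^ 2 * k ≤ 10 ^ 9 * Fintype.card F * Real.log n ^ 2 := by
  set q : ℝ := (Fintype.card F : ℝ) with hq
  have hq2 : 2 ≤ q := by rw [hq]; exact_mod_cast Fintype.one_lt_card (α := F)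
  have hnR : (6 : ℝ) ≤ n := by exact_mod_cast hn
  set m := ⌈δ * n / 3⌉₊ with hm
  have hmlow : δ * n / 3 ≤ m := Nat.le_ceil _
  have hmup : (m : ℝ) < δ * n / 3 + 1 := Nat.ceil_lt_add_one (by positivity)
  have hm0 : 0 < m := Nat.ceil_pos.2 (by positivity)
  have hmR : (0 : ℝ) < m := by exact_mod_cast hm0
  have h3m : 3 * m ≤ n := by
    have : (3 * m : ℝ) ≤ n := by nlinarith
    exact_mod_cast this
  have H : ∀ v, HasDisjointTriples F (codeRow L) m v := fun v =>
    h.hasDisjointTriples hε v m (by push_cast; linarith) h3m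
  have hmN : m ≤ n * Fintype.card F := by
    have : 1 ≤ Fintype.card F := Fintype.card_pos
    nlinarith
  set l := Real.log n with hl
  have hl1 : 1 ≤ l := by
    rw [hl, Real.le_log_iff_exp_le (by linarith)]
    linarith [Real.exp_one_lt_d9]
  have hlogN : Real.log (n * q) ≤ 2 * l := by
    rw [Real.log_mul (by linarith) (by linarith)]
    have : Real.log q ≤ l := Real.log_le_log (by linarith) (by rw [hq]; exact_mod_cast hF)
    linarith
  have hlogN0 : 0 ≤ Real.log (n * q) := Real.log_nonneg (by nlinarith)
  set T := ⌈300000 * q * l / δ⌉₊ with hTdef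
  have hTlow : 300000 * q * l / δ ≤ T := Nat.le_ceil _
  have hTup : (T : ℝ) < 300000 * q * l / δ + 1 := Nat.ceil_lt_add_one (by positivity)
  have hT : (n * q : ℝ) * (Real.log (n * q) + 8) ≤ T * (m * (1 / 100) ^ 2) := by
    calc (n * q : ℝ) * (Real.log (n * q) + 8) ≤ n * q * (10 * l) := by gcongr; linarith
      _ = (300000 * q * l / δ) * (δ * n / 3 * (1 / 100) ^ 2) := by field_simp; norm_num
      _ ≤ T * (m * (1 / 100) ^ 2) := by gcongr
  have : Finite ((Fin k → F) →ₗ[F] F) := Module.finite_of_finite F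
  have key := finrank_mul_le hm0 hmN T hT n ((Fin k → F) →ₗ[F] F) (codeRow L)
    (span_range_codeRow L hL) H Finset.univ (fun _ _ => Finset.mem_univ _) (by simp)
  have hk : Module.finrank F ((Fin k → F) →ₗ[F] F) = k := by
    rw [Module.finrank_linearMap]; simp
  rw [hk, ← hq] at key
  have hl2a : (1 / 2 : ℝ) < Real.log 2 := by linarith [Real.log_two_gt_d9]
  have hl2b : Real.log 2 < 1 := by linarith [Real.log_two_lt_d9]
  have hδn : (0 : ℝ) < δ * n := by positivity
  -- `T` is at most `300001 q l / δ`
  have hT2 : (T : ℝ) ≤ 300001 * q * l / δ := by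
    have : 1 ≤ q * l / δ := by rw [le_div_iff₀ hδ]; nlinarith
    have e : 300001 * q * l / δ = 300000 * q * l / δ + q * l / δ := by ring
    linarith
  have hD : 4 * (T * Real.log (n * q)) + Real.log 2 ≤ 2500000 * q * l ^ 2 / δ := by
    have h1 : T * Real.log (n * q) ≤ 300001 * q * l / δ * (2 * l) := by gcongr
    have h2 : 1 ≤ q * l ^ 2 / δ := by
      rw [le_div_iff₀ hδ]
      nlinarith [mul_le_mul hq2 (one_le_pow₀ hl1 (n := 2)) zero_le_one (by linarith)]
    have e1 : 300001 * q * l / δ * (2 * l) = 600002 * (q * l ^ 2 / δ) := by ring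
    have e2 : 2500000 * q * l ^ 2 / δ = 2500000 * (q * l ^ 2 / δ) := by ring
    rw [e1] at h1
    rw [e2]
    linarith
  have h4m : (4 * n + m : ℝ) ≤ 5 * n := by
    have : (m : ℝ) ≤ n := by exact_mod_cast (by omega : m ≤ n)
    linarith
  have h5 : (k : ℝ) * m * Real.log 2 ≤ 5 * n * (2500000 * q * l ^ 2 / δ) :=
    key.trans (mul_le_mul h4m hD (by positivity) (by positivity))
  have h6 : (k : ℝ) * (δ * n / 3) * (1 / 2) ≤ k * m * Real.log 2 := by gcongr
  have h7 := h6.trans h5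
  have e3 : 5 * n * (2500000 * q * l ^ 2 / δ) = n * (12500000 * (q * l ^ 2)) / δ := by ring
  rw [e3, le_div_iff₀ hδ] at h7
  have h8 : n * (δ ^ 2 * k) ≤ n * (75000000 * (q * l ^ 2)) := by nlinarith
  have h9 := le_of_mul_le_mul_left h8 (by linarith)
  have h10 : 0 ≤ q * l ^ 2 := by positivity
  nlinarith

/-- The weak exponent `1 / 8` leaves room to absorb all constants, and to settle the cases
`k ≤ (|F| - 1) ^ 2` and `n < 6`, where the left-hand side is bounded. -/
theorem IsLCC.two_rpow_le {F : Type} [Field F] [Fintype F] [DecidableEq F] {k n : ℕ}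
    {L : (Fin k → F) →ₗ[F] (Fin n → F)} {δ ε : ℝ} (hn : 2 ≤ n) (hL : Function.Injective L)
    (hδ : 0 < δ) (hε : 0 < ε) (h : IsLCC 3 δ ε L) :
    (2 : ℝ) ^ (1 / 100 * (δ ^ 2 * k / ((Fintype.card F : ℝ) - 1) ^ 2) ^ (1 / 8 : ℝ)) ≤ n := by
  have hnR : (2 : ℝ) ≤ n := by exact_mod_cast hn
  have hl2 : 0 < Real.log 2 := Real.log_pos one_lt_two
  set r : ℝ := Real.log n / Real.log 2 with hr
  have hr1 : 1 ≤ r := by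
    rw [hr, le_div_iff₀ hl2, one_mul]; exact Real.log_le_log two_pos hnR
  have hq2 : (2 : ℝ) ≤ Fintype.card F := by exact_mod_cast Fintype.one_lt_card (α := F)
  have hq1 : (1 : ℝ) ≤ (Fintype.card F : ℝ) - 1 := by linarith
  have hq1' : (1 : ℝ) ≤ ((Fintype.card F : ℝ) - 1) ^ 2 := one_le_pow₀ hq1
  set x : ℝ := δ ^ 2 * k / ((Fintype.card F : ℝ) - 1) ^ 2 with hx
  have hx0 : 0 ≤ x := by positivity
  suffices hmain : x ≤ (100 * r) ^ 8 by
    have h1 : x ^ (1 / 8 : ℝ) ≤ 100 * r := by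
      calc x ^ (1 / 8 : ℝ) ≤ ((100 * r) ^ 8) ^ (1 / 8 : ℝ) := by gcongr
        _ = 100 * r := by
          rw [← Real.rpow_natCast, ← Real.rpow_mul (by positivity)]; norm_num
    calc (2 : ℝ) ^ (1 / 100 * x ^ (1 / 8 : ℝ)) ≤ (2 : ℝ) ^ r :=
          Real.rpow_le_rpow_of_exponent_le one_le_two (by linarith)
      _ = n := by
        rw [hr, Real.log_div_log, Real.rpow_logb two_pos (by norm_num) (by linarith)]
  have hone : (1 : ℝ) ≤ r ^ 8 := one_le_pow₀ hr1
  have hbig : (10 : ℝ) ^ 16 * r ^ 2 ≤ (100 * r) ^ 8 := by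
    rw [mul_pow]
    norm_num
    exact pow_le_pow_right₀ hr1 (by norm_num)
  have hrsq : (1 : ℝ) ≤ r ^ 2 := one_le_pow₀ hr1
  rcases Nat.eq_zero_or_pos k with hk | hk
  · simp only [hx, hk, Nat.cast_zero, mul_zero, zero_div]; positivity
  have hδ1 : δ < 1 := h.lt_one hL hk hε
  have hkn : k ≤ n := by
    have := LinearMap.finrank_le_finrank_of_injective hL
    simpa using this
  have hδsq : δ ^ 2 ≤ 1 := by nlinarith
  by_cases hFk : (k : ℝ) ≤ ((Fintype.card F : ℝ) - 1) ^ 2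
  · have : x ≤ 1 := by
      rw [hx, div_le_one (by linarith)]
      nlinarith [Nat.cast_nonneg (α := ℝ) k]
    linarith
  push Not at hFk
  by_cases hn6 : n < 6
  · have h1 : x ≤ 6 := by
      rw [hx, div_le_iff₀ (by linarith)]
      have : (k : ℝ) ≤ 6 := by exact_mod_cast (by omega : k ≤ 6)
      nlinarith [Nat.cast_nonneg (α := ℝ) k]
    linarith
  push Not at hn6
  have hFn : Fintype.card F ≤ n := by
    have h1 : ((Fintype.card F : ℝ) - 1) < n := by
      have : (k : ℝ) ≤ n := by exact_mod_cast hkn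
      nlinarith
    have h2 : (Fintype.card F : ℝ) < (n + 1 : ℕ) := by push_cast; linarith
    exact Nat.lt_succ_iff.1 (by exact_mod_cast h2)
  have hmin : δ / 2 ≤ δ := by linarith
  have key := (h.mono hmin).sq_mul_le hn6 hL (by linarith) (by linarith) hε hFn
  have h2 : (Fintype.card F : ℝ) ≤ 2 * ((Fintype.card F : ℝ) - 1) ^ 2 := by nlinarith
  have hlog : Real.log n ^ 2 ≤ r ^ 2 := by
    have h3 : Real.log n = r * Real.log 2 := by rw [hr]; field_simp
    have h4 : Real.log 2 ≤ 1 := by linarith [Real.log_two_lt_d9]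
    rw [h3, mul_pow]
    have : Real.log 2 ^ 2 ≤ 1 := by nlinarith
    nlinarith
  have h5 : x ≤ 10 ^ 16 * r ^ 2 := by
    rw [hx, div_le_iff₀ (by linarith)]
    have h6 : (Fintype.card F : ℝ) * Real.log n ^ 2 ≤
        2 * ((Fintype.card F : ℝ) - 1) ^ 2 * r ^ 2 := by gcongr
    have h7 : 0 ≤ ((Fintype.card F : ℝ) - 1) ^ 2 * r ^ 2 := by positivity
    nlinarith
  exact h5.trans hbig

/-! ### Matching vectors modulo 511 -/

/-- By the theorem of Lucas, `C(y, p ^ e - 1)` detects modulo `p` whether `p ^ e`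
divides `y + 1`. -/
theorem choose_prime_pow_sub_one_modEq (p : ℕ) [Fact p.Prime] (e y : ℕ) :
    y.choose (p ^ e - 1) ≡ (if p ^ e ∣ y + 1 then 1 else 0) [MOD p] := by
  have hp : 0 < p := (Fact.out : p.Prime).pos
  induction e generalizing y with
  | zero => simp; rfl
  | succ e ih =>
    have hpe : 0 < p ^ e := pow_pos hp e
    have hk : p ^ (e + 1) - 1 = (p - 1) + p * (p ^ e - 1) := by
      obtain ⟨q, hq⟩ : ∃ q, p ^ e = q + 1 := ⟨p ^ e - 1, by omega⟩
      obtain ⟨r, hr⟩ : ∃ r, p = r + 1 := ⟨p - 1, by omega⟩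
      rw [pow_succ, hq, hr]
      simp only [Nat.add_sub_cancel]
      rw [show (q + 1) * (r + 1) = r + (r + 1) * q + 1 by ring]
      rfl
    have h1 : (p ^ (e + 1) - 1) % p = p - 1 := by
      rw [hk, Nat.add_mul_mod_self_left, Nat.mod_eq_of_lt (by omega)]
    have h2 : (p ^ (e + 1) - 1) / p = p ^ e - 1 := by
      rw [hk, Nat.add_mul_div_left _ _ hp, Nat.div_eq_of_lt (by omega), zero_add]
    have h3 := Choose.choose_modEq_choose_mod_mul_choose_div_nat (n := y) (k := p ^ (e + 1) - 1)
      (p := p)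
    rw [h1, h2] at h3
    refine h3.trans ?_
    have hlt := Nat.mod_lt y hp
    have hdm := Nat.mod_add_div y p
    by_cases hy : y % p = p - 1
    · rw [hy, Nat.choose_self, one_mul]
      have : p ^ (e + 1) ∣ y + 1 ↔ p ^ e ∣ y / p + 1 := by
        have h4 : y + 1 = p * (y / p + 1) := by rw [mul_add, mul_one]; omega
        rw [h4, pow_succ, mul_comm (p ^ e), Nat.mul_dvd_mul_iff_left hp]
      simp only [this]
      exact ih (y / p)
    · rw [Nat.choose_eq_zero_of_lt (by omega), zero_mul, if_neg]
      intro hd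
      have h5 : p ∣ y + 1 := (dvd_pow_self p (Nat.succ_ne_zero e)).trans hd
      have h6 : (y % p + 1) % p = 0 := by
        rw [← Nat.add_mod_eq_add_mod_right 1 (Nat.mod_mod y p).symm]
        exact Nat.mod_eq_zero_of_dvd h5
      rw [Nat.mod_eq_of_lt (by omega)] at h6
      omega

theorem natCast_mul_eq_of_modEq {N p c y r : ℕ} (hN : N ∣ c * p) (h : y ≡ r [MOD p]) :
    (c : ZMod N) * y = c * r := by
  have h1 : c * y ≡ c * r [MOD c * p] := h.mul_left' c
  exact_mod_cast (ZMod.natCast_eq_natCast_iff _ _ _).2 (h1.of_dvd hN)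

/-- Modulo `511 = 7 · 73`, the polynomial `1 - 365 C(y, 7 ^ a - 1) - 147 C(y, 73 ^ b - 1)`
vanishes for `y + 1 = 7 ^ a 73 ^ b`, and has only three values for smaller `y`. The coefficients
`365` and `147` are the idempotents of `ℤ/511`. -/
theorem orPolynomial_values (a b y w : ℕ) (hw : w + 1 = 7 ^ a * 73 ^ b) (hy : y ≤ w) :
    (y = w → (1 - (365 : ℕ) * (y.choose (7 ^ a - 1) : ℕ) -
      (147 : ℕ) * (y.choose (73 ^ b - 1) : ℕ) : ZMod 511) = 0) ∧
    (y ≠ w → (1 - (365 : ℕ) * (y.choose (7 ^ a - 1) : ℕ) -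
      (147 : ℕ) * (y.choose (73 ^ b - 1) : ℕ) : ZMod 511) ∈
        ({1, 147, 365} : Finset (ZMod 511))) := by
  have : Fact (Nat.Prime 7) := ⟨by norm_num⟩
  have : Fact (Nat.Prime 73) := ⟨by norm_num⟩
  rw [natCast_mul_eq_of_modEq (by decide) (choose_prime_pow_sub_one_modEq 7 a y),
    natCast_mul_eq_of_modEq (by decide) (choose_prime_pow_sub_one_modEq 73 b y)]
  refine ⟨fun h => ?_, fun h => ?_⟩
  · rw [if_pos (by rw [h, hw]; exact dvd_mul_right _ _),
      if_pos (by rw [h, hw]; exact dvd_mul_left _ _)]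
    decide
  · by_cases h7 : 7 ^ a ∣ y + 1 <;> by_cases h73 : 73 ^ b ∣ y + 1
    · have hco : Nat.Coprime (7 ^ a) (73 ^ b) := Nat.Coprime.pow _ _ (by norm_num)
      have := Nat.le_of_dvd (Nat.succ_pos _) (hco.mul_dvd_of_dvd_of_dvd h7 h73)
      omega
    all_goals
      simp only [h7, h73, if_true, if_false]
      decide

/-- The graph of a bit string `x`. Two graphs have as many common points as the strings agree in. -/
def bitGraph {w : ℕ} (x : Fin w → Bool) : Finset (Fin w × Bool) :=
  Finset.univ.filter fun s => x s.1 = s.2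

theorem card_bitGraph_inter {w : ℕ} (x y : Fin w → Bool) :
    (bitGraph x ∩ bitGraph y).card ≤ w ∧ ((bitGraph x ∩ bitGraph y).card = w ↔ x = y) := by
  have h : (bitGraph x ∩ bitGraph y).card = (Finset.univ.filter fun i => x i = y i).card := by
    symm
    refine Finset.card_bij (fun i _ => (i, x i)) ?_ ?_ ?_
    · intro i hi
      have : x i = y i := (Finset.mem_filter.1 hi).2
      simp [bitGraph, this]
    · intro i _ j _ hij; exact (Prod.mk.inj hij).1
    · rintro ⟨i, c⟩ hs
      simp only [bitGraph, Finset.mem_inter, Finset.mem_filter, Finset.mem_univ, true_and] at hs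
      exact ⟨i, by simp [hs.1, hs.2], by simp [hs.1]⟩
  rw [h]
  refine ⟨(Finset.card_le_univ _).trans (by simp), ?_⟩
  have h2 := Finset.card_eq_iff_eq_univ (Finset.univ.filter fun i => x i = y i)
  rw [Fintype.card_fin] at h2
  rw [h2, Finset.filter_eq_self]
  simp [funext_iff]

/-- The number of common subsets of size `D`, as an inner product of indicator vectors. -/
theorem sum_indicator_subsets {w D : ℕ} (A B : Finset (Fin w × Bool)) :
    ∑ s : {s : Finset (Fin w × Bool) // s.card = D},
      ((if s.1 ⊆ A then 1 else 0) * (if s.1 ⊆ B then 1 else 0) : ZMod 511) =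
      ((A ∩ B).card.choose D : ℕ) := by
  rw [← Finset.card_powersetCard, ← Finset.sum_subtype (Finset.univ.filter fun s => s.card = D)
    (by simp) (fun s => ((if s ⊆ A then 1 else 0) * (if s ⊆ B then 1 else 0) : ZMod 511))]
  have : ∀ s : Finset (Fin w × Bool), ((if s ⊆ A then 1 else 0) * (if s ⊆ B then 1 else 0) :
      ZMod 511) = if s ⊆ A ∩ B then 1 else 0 := by
    intro s
    simp only [Finset.subset_inter_iff]
    split_ifs <;> simp_all
  simp only [this]
  rw [Finset.sum_boole, Finset.filter_filter]
  congr 2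
  ext s
  simp [Finset.mem_powersetCard, and_comm]

/-- Grolmusz’s family of matching vectors modulo `511`, with off-diagonal products in a set of three
elements: the polynomial of `orPolynomial_values`, evaluated at the number of agreements of two bit
strings of length `w`, is an inner product of vectors indexed by sets of pairs. -/
theorem exists_matchingVectors (a b w k : ℕ) (hw : w + 1 = 7 ^ a * 73 ^ b) (hk : k ≤ 2 ^ w) :
    ∃ (h : ℕ) (u v : Fin k → Fin h → ZMod 511),
      h ≤ 1 + (2 * w) ^ (7 ^ a - 1) + (2 * w) ^ (73 ^ b - 1) ∧ (∀ i, u i ⬝ᵥ v i = 0) ∧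
      ∀ i j, i ≠ j → u i ⬝ᵥ v j ∈ ({1, 147, 365} : Finset (ZMod 511)) := by
  classical
  let J : Type := Unit ⊕ ({s : Finset (Fin w × Bool) // s.card = 7 ^ a - 1} ⊕
    {s : Finset (Fin w × Bool) // s.card = 73 ^ b - 1})
  let U : (Fin w → Bool) → J → ZMod 511 := fun x => Sum.elim (fun _ => 1) (Sum.elim
    (fun s => -((365 : ℕ) : ZMod 511) * if s.1 ⊆ bitGraph x then 1 else 0)
    (fun s => -((147 : ℕ) : ZMod 511) * if s.1 ⊆ bitGraph x then 1 else 0))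
  let V : (Fin w → Bool) → J → ZMod 511 := fun x => Sum.elim (fun _ => 1) (Sum.elim
    (fun s => if s.1 ⊆ bitGraph x then 1 else 0) (fun s => if s.1 ⊆ bitGraph x then 1 else 0))
  have hUV : ∀ x y, U x ⬝ᵥ V y =
      1 - (365 : ℕ) * ((bitGraph x ∩ bitGraph y).card.choose (7 ^ a - 1) : ℕ) -
        (147 : ℕ) * ((bitGraph x ∩ bitGraph y).card.choose (73 ^ b - 1) : ℕ) := by
    intro x y
    simp only [dotProduct, J, U, V, Fintype.sum_sum_type, Sum.elim_inl, Sum.elim_inr, mul_assoc,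
      ← Finset.mul_sum, sum_indicator_subsets]
    simp
    ring
  have hcard : Fintype.card J ≤ 1 + (2 * w) ^ (7 ^ a - 1) + (2 * w) ^ (73 ^ b - 1) := by
    simp only [J, Fintype.card_sum, Fintype.card_finset_len, Fintype.card_prod, Fintype.card_fin,
      Fintype.card_bool, Fintype.card_unit, mul_comm w 2]
    have h1 := Nat.choose_le_pow (2 * w) (7 ^ a - 1)
    have h2 := Nat.choose_le_pow (2 * w) (73 ^ b - 1)
    omega
  obtain ⟨x⟩ : Nonempty (Fin k ↪ (Fin w → Bool)) :=
    Function.Embedding.nonempty_of_card_le (by simpa using hk)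
  let e := Fintype.equivFin J
  have hdot : ∀ i j, (U (x i) ∘ e.symm) ⬝ᵥ (V (x j) ∘ e.symm) = U (x i) ⬝ᵥ V (x j) := fun i j =>
    Equiv.sum_comp e.symm (fun s => U (x i) s * V (x j) s)
  refine ⟨Fintype.card J, fun i => U (x i) ∘ e.symm, fun i => V (x i) ∘ e.symm, hcard, ?_, ?_⟩
  · intro i
    rw [hdot, hUV]
    have h1 := card_bitGraph_inter (x i) (x i)
    exact (orPolynomial_values a b _ w hw h1.1).1 (h1.2.2 rfl)
  · intro i j hij
    rw [hdot, hUV]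
    have h1 := card_bitGraph_inter (x i) (x j)
    exact (orPolynomial_values a b _ w hw h1.1).2 (fun h => hij (x.injective (h1.2.1 h)))

/-! ### A trinomial over the field with 512 elements -/

section Trinomial

variable {R : Type*} [CommRing R] {r : R}

/-- The iterated squares of a root of `X ^ 9 + X ^ 4 + 1` in characteristic two. The coefficients of
`h9` in the proofs are quotients of divisions by `X ^ 9 - X ^ 4 - 1`, and those of `h2` are halves
of the remainders that vanish modulo two; this also applies to the identities below. -/
theorem root_pow_two_pow (h2 : (2 : R) = 0) (h9 : r ^ 9 = r ^ 4 + 1) :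
    r ^ 32 = r ^ 7 + r ^ 5 + r ^ 3 + 1 ∧ r ^ 64 = r ^ 6 + r ^ 4 + r ∧
      r ^ 256 = r ^ 7 + r ^ 5 + r ^ 2 + 1 ∧ r ^ 512 = r := by
  have h16 : r ^ 16 = r ^ 7 + r ^ 6 + r ^ 2 := by
    linear_combination (r ^ 7 + r ^ 2) * h9
  have h32 : r ^ 32 = r ^ 7 + r ^ 5 + r ^ 3 + 1 := by
    linear_combination (r ^ 16 + (r ^ 7 + r ^ 6 + r ^ 2)) * h16 + (r ^ 5 + 2 * r ^ 4 + r ^ 3 + 3)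
      * h9 + (2 * r ^ 8 + 3 * r ^ 4 + 1) * h2
  have h64 : r ^ 64 = r ^ 6 + r ^ 4 + r := by
    linear_combination (r ^ 32 + (r ^ 7 + r ^ 5 + r ^ 3 + 1)) * h32 + (r ^ 5 + 2 * r ^ 3 + 3 * r +
      1) * h9 + (r ^ 8 + 2 * r ^ 7 + 3 * r ^ 5 + 2 * r ^ 3 + r + 1) * h2
  have h128 : r ^ 128 = r ^ 8 + r ^ 7 + r ^ 3 + r ^ 2 := by
    linear_combination (r ^ 64 + (r ^ 6 + r ^ 4 + r)) * h64 + (r ^ 3 + 2 * r) * h9 + (r ^ 7 + 2 *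
      r ^ 5 + r) * h2
  have h256 : r ^ 256 = r ^ 7 + r ^ 5 + r ^ 2 + 1 := by
    linear_combination (r ^ 128 + (r ^ 8 + r ^ 7 + r ^ 3 + r ^ 2)) * h128 + (r ^ 7 + 2 * r ^ 6 + r
      ^ 5 + 3 * r ^ 2 + 6 * r + 3) * h9 + (3 * r ^ 6 + 4 * r ^ 5 + 2 * r ^ 4 + r ^ 2 + 3 * r + 1)
      * h2
  have h512 : r ^ 512 = r := by
    linear_combination (r ^ 256 + (r ^ 7 + r ^ 5 + r ^ 2 + 1)) * h256 + (r ^ 5 + 2 * r ^ 3 + r +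
      3) * h9 + (3 * r ^ 7 + 2 * r ^ 5 + 2 * r ^ 4 + r ^ 3 + r ^ 2 + 2) * h2
  exact ⟨h32, h64, h256, h512⟩

/-- The powers of a root of `X ^ 9 + X ^ 4 + 1` in characteristic two that the trinomial
`1 + r ^ 362 X ^ 3 + r ^ 148 X ^ 144` and the order of `r` involve. -/
theorem trinomial_powers (h2 : (2 : R) = 0) (h9 : r ^ 9 = r ^ 4 + 1) :
    r ^ 73 = r ^ 8 + r ^ 6 + r ^ 4 ∧ 1 + r ^ 365 + r ^ 292 = 0 ∧ 1 + r ^ 435 + r ^ 75 = 0 ∧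
      1 + r ^ 362 + r ^ 148 = r ^ 170 := by
  obtain ⟨h32, h64, h256, -⟩ := root_pow_two_pow h2 h9
  have h73 : r ^ 73 = r ^ 8 + r ^ 6 + r ^ 4 := by
    linear_combination r ^ 9 * h64 + (r ^ 6 + r ^ 4 + r) * h9 + (r) * h9 + (r ^ 5 + r) * h2
  have h75 : r ^ 75 = r ^ 8 + r ^ 6 + r ^ 5 + r := by
    linear_combination r ^ 2 * h73 + (r) * h9
  have h146 : r ^ 146 = r ^ 8 + r ^ 6 + r ^ 3 + r ^ 2 := by
    linear_combination (r ^ 73 + (r ^ 8 + r ^ 6 + r ^ 4)) * h73 + (r ^ 7 + 2 * r ^ 5 + 3 * r ^ 3 +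
      r ^ 2 + 2 * r + 2) * h9 + (2 * r ^ 7 + 2 * r ^ 5 + r ^ 4 + r ^ 3 + r + 1) * h2
  have h148 : r ^ 148 = r ^ 8 + r ^ 4 + r := by
    linear_combination r ^ 2 * h146 + (r) * h9 + (r ^ 5) * h2
  have h292 : r ^ 292 = r ^ 4 + r ^ 3 + r ^ 2 := by
    linear_combination (r ^ 146 + (r ^ 8 + r ^ 6 + r ^ 3 + r ^ 2)) * h146 + (r ^ 7 + 2 * r ^ 5 + r
      ^ 3 + 3 * r ^ 2 + 2 * r + 4) * h9 + (r ^ 8 + r ^ 7 + 2 * r ^ 6 + 3 * r ^ 5 + 2 * r ^ 4 + r ^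
      2 + r + 2) * h2
  have h365 : r ^ 365 = r ^ 4 + r ^ 3 + r ^ 2 + 1 := by
    linear_combination r ^ 73 * h292 + (r ^ 4 + r ^ 3 + r ^ 2) * h73 + (r ^ 3 + r ^ 2 + 2 * r + 1)
      * h9 + (r ^ 8 + r ^ 7 + r ^ 6 + r ^ 5 + r) * h2
  have h96 : r ^ 96 = r ^ 7 + r ^ 4 + r := by
    linear_combination r ^ 32 * h64 + (r ^ 6 + r ^ 4 + r) * h32 + (r ^ 4 + 2 * r ^ 2 + 2) * h9 +
      (r ^ 8 + 2 * r ^ 6 + 2 * r ^ 4 + r ^ 2 + 1) * h2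
  have h170 : r ^ 170 = r ^ 6 + r ^ 4 + r ^ 3 + r := by
    linear_combination r ^ 73 * r * h96 + (r ^ 7 + r ^ 4 + r) * r * h73 + (r ^ 7 + r ^ 5 + r ^ 4 +
      r ^ 3 + 2 * r ^ 2 + r + 2) * h9 + (r ^ 8 + r ^ 7 + r ^ 6 + r ^ 5 + r ^ 4 + r ^ 2 + 1) * h2
  have h106 : r ^ 106 = r ^ 8 + r ^ 7 + r ^ 6 + r ^ 5 + r ^ 4 + r ^ 3 + r ^ 2 + 1 := by
    linear_combination r ^ 32 * r * h73 + (r ^ 8 + r ^ 6 + r ^ 4) * r * h32 + (r ^ 7 + 2 * r ^ 5 +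
      3 * r ^ 3 + r ^ 2 + 2 * r + 3) * h9 + (2 * r ^ 7 + 2 * r ^ 5 + r ^ 4 + r ^ 3 + r + 1) * h2
  have h362 : r ^ 362 = r ^ 8 + r ^ 6 + r ^ 3 + 1 := by
    linear_combination r ^ 106 * h256 + (r ^ 7 + r ^ 5 + r ^ 2 + 1) * h106 + (r ^ 6 + r ^ 5 + 2 *
      r ^ 4 + 2 * r ^ 3 + 2 * r ^ 2 + 4 * r + 4) * h9 + (2 * r ^ 8 + 3 * r ^ 7 + 2 * r ^ 6 + 4 * r
      ^ 5 + 4 * r ^ 4 + r ^ 3 + 2 * r ^ 2 + 2 * r + 2) * h2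
  have h435 : r ^ 435 = r ^ 8 + r ^ 6 + r ^ 5 + r + 1 := by
    linear_combination r ^ 73 * h362 + (r ^ 8 + r ^ 6 + r ^ 3 + 1) * h73 + (r ^ 7 + 2 * r ^ 5 + 2
      * r ^ 3 + 2 * r ^ 2 + r + 3) * h9 + (2 * r ^ 7 + r ^ 6 + r ^ 5 + 2 * r ^ 4 + r ^ 3 + r ^ 2 +
      1) * h2
  refine ⟨h73, ?_, ?_, ?_⟩
  · linear_combination h365 + h292 + (r ^ 4 + r ^ 3 + r ^ 2 + 1) * h2
  · linear_combination h435 + h75 + (r ^ 8 + r ^ 6 + r ^ 5 + r + 1) * h2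
  · linear_combination h362 + h148 - h170 + (r ^ 8 + 1) * h2

end Trinomial

/-- A root of the primitive polynomial `X ^ 9 + X ^ 4 + 1` generates the multiplicative group of
the field with 512 elements. -/
theorem orderOf_root_eq {K : Type*} [Field K] {r : K} (h2 : (2 : K) = 0) (h9 : r ^ 9 = r ^ 4 + 1) :
    orderOf r = 511 := by
  have h0 : r ≠ 0 := by
    rintro rfl
    simp at h9
  have h511 : r ^ 511 = 1 := by
    apply mul_right_cancel₀ h0
    rw [← pow_succ, (root_pow_two_pow h2 h9).2.2.2, one_mul]
  have h7 : r ^ 7 ≠ 1 := by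
    intro h
    apply one_ne_zero (α := K)
    linear_combination (r ^ 6 + r ^ 5 + r ^ 4 + r ^ 3 + 1) * h9 + (r ^ 8 + r ^ 7 + r ^ 6 + r ^ 5 +
      r ^ 3) * h - (r ^ 15 + r ^ 14 + r ^ 13 + r ^ 12 + -1 * r ^ 8 + -1 * r ^ 7 + -1 * r ^ 6 + -1
      * r ^ 5 + -1 * r ^ 4 + -1 * r ^ 3 + -1) * h2
  have h73 : r ^ 73 ≠ 1 := by
    intro h
    rw [(trinomial_powers h2 h9).1] at h
    apply one_ne_zero (α := K)
    linear_combination (r ^ 3 + r ^ 2 + 1) * h9 + (r ^ 4 + r ^ 3 + r ^ 2) * h - (r ^ 12 + r ^ 11 +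
      r ^ 10 + r ^ 9 + r ^ 8 + -1 * r ^ 4 + -1 * r ^ 3 + -1 * r ^ 2 + -1) * h2
  refine orderOf_eq_of_pow_and_pow_div_prime (by norm_num) h511 fun p hp hpd => ?_
  have : p = 7 ∨ p = 73 := by
    have h' : p ∣ 7 * 73 := hpd
    rcases (Nat.Prime.dvd_mul hp).1 h' with h | h
    · exact Or.inl ((Nat.prime_dvd_prime_iff_eq hp (by norm_num)).1 h)
    · exact Or.inr ((Nat.prime_dvd_prime_iff_eq hp (by norm_num)).1 h)
  rcases this with rfl | rfl
  · exact h73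
  · exact h7

open Polynomial in
/-- By the computation of `r ^ 512` for the universal root, `X ^ 9 - X ^ 4 - 1` divides
`X ^ 512 - X`, which splits over the field with 512 elements. -/
theorem exists_root_galoisField : ∃ r : GaloisField 2 9, r ^ 9 = r ^ 4 + 1 := by
  set f : (ZMod 2)[X] := X ^ 9 - (X ^ 4 + 1) with hf
  have hdeg : f.natDegree = 9 := by
    rw [hf]; compute_degree!
  have hdvd : f ∣ X ^ 512 - X := by
    rw [← AdjoinRoot.mk_eq_zero]
    have hr : (AdjoinRoot.root f) ^ 9 = (AdjoinRoot.root f) ^ 4 + 1 := by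
      have h : AdjoinRoot.mk f (X ^ 9 - (X ^ 4 + 1)) = 0 := AdjoinRoot.mk_self
      simpa [sub_eq_zero] using h
    have h2 : (2 : AdjoinRoot f) = 0 := by
      have h : (2 : ZMod 2) = 0 := by decide
      rw [← map_ofNat (AdjoinRoot.of f) 2, h, map_zero]
    simpa [sub_eq_zero] using (root_pow_two_pow h2 hr).2.2.2
  have hcard : Nat.card (GaloisField 2 9) = 512 := by
    rw [GaloisField.card 2 9 (by norm_num)]; norm_num
  have hsplit := FiniteField.splits_X_pow_nat_card_sub_X (K := GaloisField 2 9) 2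
  rw [hcard] at hsplit
  have hs : (f.map (algebraMap (ZMod 2) (GaloisField 2 9))).Splits := by
    refine hsplit.of_dvd ?_ (Polynomial.map_dvd _ hdvd)
    rw [Polynomial.map_ne_zero_iff (algebraMap (ZMod 2) (GaloisField 2 9)).injective]
    exact FiniteField.X_pow_card_sub_X_ne_zero _ (by norm_num)
  obtain ⟨r, hr⟩ := hs.exists_eval_eq_zero (by
    rw [degree_map, degree_eq_natDegree (fun h => by simp [h] at hdeg), hdeg]
    norm_num)
  refine ⟨r, ?_⟩
  simpa [hf, sub_eq_zero] using hr

/-- The field with 512 elements has an element `γ` of order 511 and a polynomial with three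
nonzero terms which vanishes at the powers `γ ^ s`, where `s` runs over the nonzero idempotents
`1`, `147`, `365` modulo `511 = 7 * 73`, and takes the value `1` at `1`. -/
theorem exists_trinomial : ∃ γ : (GaloisField 2 9)ˣ, orderOf γ = 511 ∧
    ∃ (a : Fin 3 → GaloisField 2 9) (l : Fin 3 → ZMod 511), (∀ j, a j ≠ 0) ∧ ∑ j, a j = 1 ∧
      ∀ s ∈ ({1, 147, 365} : Finset (ZMod 511)),
        ∑ j, a j * (γ : GaloisField 2 9) ^ (l j * s).val = 0 := by
  obtain ⟨r, h9⟩ := exists_root_galoisField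
  have h2 : (2 : GaloisField 2 9) = 0 := CharTwo.two_eq_zero
  have h0 : r ≠ 0 := by
    rintro rfl
    simp at h9
  obtain ⟨-, hs1, hs2, hz⟩ := trinomial_powers h2 h9
  have hz0 : r ^ 170 ≠ 0 := pow_ne_zero _ h0
  -- `1 + r ^ 362 X ^ 3 + r ^ 148 X ^ 144`, divided by its value `r ^ 170` at `1`
  refine ⟨Units.mk0 r h0, ?_, fun j => r ^ (![0, 362, 148] j) / r ^ 170, ![0, 3, 144], ?_, ?_, ?_⟩
  · rw [← orderOf_units, Units.val_mk0, orderOf_root_eq h2 h9]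
  · intro j
    exact div_ne_zero (pow_ne_zero _ h0) hz0
  · rw [← Finset.sum_div, div_eq_one_iff_eq hz0, ← hz]
    simp [Fin.sum_univ_three]
  · have h511 : r ^ 511 = 1 := orderOf_root_eq h2 h9 ▸ pow_orderOf_eq_one r
    intro s hs
    simp only [div_mul_eq_mul_div, ← Finset.sum_div, Units.val_mk0, ← pow_add]
    rw [div_eq_zero_iff]
    left
    have hmod (i : ℕ) : r ^ i = r ^ (i % 511) := pow_eq_pow_mod i h511
    simp only [Finset.mem_insert, Finset.mem_singleton] at hs
    rcases hs with rfl | rfl | rfl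
    · rw [← hs1, Fin.sum_univ_three]
      exact congrArg₂ (· + ·) (congrArg₂ (· + ·) (pow_zero r) (hmod _)) (hmod _)
    · rw [← hs1, Fin.sum_univ_three, add_right_comm]
      exact congrArg₂ (· + ·) (congrArg₂ (· + ·) (pow_zero r) (hmod _)) (hmod _)
    · rw [← hs2, Fin.sum_univ_three]
      exact congrArg₂ (· + ·) (congrArg₂ (· + ·) (pow_zero r) (hmod _)) (hmod _)

/-! ### Local decoding of matching vector codes -/

namespace QueryTree

/-- The algorithm that reads the positions of a list, and adds the symbols there to `s`. -/
def sumAlong {n : ℕ} {F : Type} [Add F] : List (Fin n) → F → QueryTree n F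
  | [], s => output s
  | p :: ps, s => query p fun c => sumAlong ps (s + c)

theorem run_sumAlong {n : ℕ} {F : Type} [AddMonoid F] (y : Fin n → F) (ps : List (Fin n)) (s : F) :
    (sumAlong ps s).run y = s + (ps.map y).sum := by
  induction ps generalizing s with
  | nil => simp [sumAlong, run]
  | cons p ps ih => simp [sumAlong, run, ih, add_assoc]

theorem numQueries_sumAlong {n : ℕ} {F : Type} [Add F] (y : Fin n → F) (ps : List (Fin n)) (s : F) :
    (sumAlong ps s).numQueries y = ps.length := by
  induction ps generalizing s with
  | nil => simp [sumAlong, numQueries]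
  | cons p ps ih => simp [sumAlong, numQueries, ih]

end QueryTree

theorem outputProb_map_uniform {n : ℕ} {F Ω : Type} [DecidableEq F] [Fintype Ω] [Nonempty Ω]
    (T : Ω → QueryTree n F) (y : Fin n → F) (a : F) :
    outputProb ((PMF.uniformOfFintype Ω).map T) y a =
      (Finset.univ.filter fun ω => (T ω).run y = a).card / (Fintype.card Ω : ℝ) := by
  rw [outputProb, PMF.map_comp, PMF.map_apply, tsum_fintype]
  simp only [Function.comp_apply, PMF.uniformOfFintype_apply]
  rw [← Finset.sum_filter, Finset.sum_const, nsmul_eq_mul, ENNReal.toReal_mul, ENNReal.toReal_inv,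
    ENNReal.toReal_natCast, ENNReal.toReal_natCast, div_eq_mul_inv]
  congr 3
  ext ω
  simp only [Finset.mem_filter, Finset.mem_univ, true_and]
  exact eq_comm

/-- A nonadaptive decoder succeeds if its output is right on the codeword and each of its queries
hits every position for at most one choice of its randomness. -/
theorem isLDC_of_sum_queries {F : Type} [DecidableEq F] [AddCommMonoid F] {k n q : ℕ}
    {L : (Fin k → F) → (Fin n → F)} {Ω : Type} [Fintype Ω] [Nonempty Ω]
    (p : Fin k → Fin q → Ω → Fin n) (hinj : ∀ i j, Function.Injective (p i j))
    (hp : ∀ b i ω, ∑ j, L b (p i j ω) = b i) (hn : n = 2 * Fintype.card Ω) (δ : ℝ) :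
    IsLDC q δ (1 / 2 - 2 * q * δ) L := by
  classical
  refine ⟨fun i => (PMF.uniformOfFintype Ω).map fun ω =>
    QueryTree.sumAlong (List.ofFn fun j => p i j ω) 0, ?_, ?_⟩
  · intro i T hT y
    rw [PMF.support_map] at hT
    obtain ⟨ω, -, rfl⟩ := hT
    rw [QueryTree.numQueries_sumAlong, List.length_ofFn]
  · intro b i y hy
    rw [outputProb_map_uniform]
    have hΩ : (0 : ℝ) < Fintype.card Ω := by exact_mod_cast Fintype.card_pos
    rw [le_div_iff₀ hΩ]
    set good := Finset.univ.filter fun ω : Ω =>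
      (QueryTree.sumAlong (List.ofFn fun j => p i j ω) 0).run y = b i
    -- the decoder errs only if some query reads a corrupted position
    have hcover : (Finset.univ : Finset Ω) ⊆ good ∪ Finset.univ.biUnion fun j : Fin q =>
        Finset.univ.filter fun ω => y (p i j ω) ≠ L b (p i j ω) := by
      intro ω _
      by_cases h : ∃ j, y (p i j ω) ≠ L b (p i j ω)
      · obtain ⟨j, hj⟩ := h
        exact Finset.mem_union_right _ (Finset.mem_biUnion.2
          ⟨j, Finset.mem_univ _, Finset.mem_filter.2 ⟨Finset.mem_univ _, hj⟩⟩)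
      · push Not at h
        refine Finset.mem_union_left _ (Finset.mem_filter.2 ⟨Finset.mem_univ _, ?_⟩)
        rw [QueryTree.run_sumAlong, List.map_ofFn, List.sum_ofFn, zero_add, ← hp b i ω]
        exact Finset.sum_congr rfl fun j _ => h j
    have hbad (j : Fin q) : (Finset.univ.filter fun ω => y (p i j ω) ≠ L b (p i j ω)).card ≤
        hammingDist y (L b) :=
      Finset.card_le_card_of_injOn (p i j) (fun ω hω => by simpa using hω) (hinj i j).injOn
    have hcount : Fintype.card Ω ≤ good.card + q * hammingDist y (L b) := by
      refine (Finset.card_le_card hcover).trans ((Finset.card_union_le _ _).trans ?_)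
      refine Nat.add_le_add_left (Finset.card_biUnion_le.trans ?_) _
      exact (Finset.sum_le_sum fun j _ => hbad j).trans (by simp)
    have hcount' : (Fintype.card Ω : ℝ) ≤ good.card + q * hammingDist y (L b) := by
      exact_mod_cast hcount
    have hn' : (n : ℝ) = 2 * Fintype.card Ω := by exact_mod_cast hn
    rw [hn'] at hy
    have := mul_le_mul_of_nonneg_left hy (Nat.cast_nonneg (α := ℝ) q)
    nlinarith

section MatchingVectorCode

theorem pow_val_add {K : Type} [Field K] {m : ℕ} [NeZero m] {γ : Kˣ} (hγ : orderOf γ = m)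
    (x y : ZMod m) : (γ : K) ^ (x + y).val = (γ : K) ^ x.val * (γ : K) ^ y.val := by
  rw [ZMod.val_add, ← pow_add, ← Units.val_pow_eq_pow_val, ← Units.val_pow_eq_pow_val]
  congr 1
  exact (pow_eq_pow_mod _ (hγ ▸ pow_orderOf_eq_one γ)).symm

/-- A polynomial `∑ j, a_j X ^ (l_j)` which vanishes at `γ ^ ⟨u_r, v_i⟩` for all `r ≠ i` and is `1`
at `1` recovers `b_i` from the symbols on the line through `x` in the direction `v_i`. -/
theorem sum_matchingVectorSymbol_line {K : Type} [Field K] {m h k q : ℕ} [NeZero m] {γ : Kˣ}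
    (hγ : orderOf γ = m) {u v : Fin k → Fin h → ZMod m} {S : Finset (ZMod m)}
    (hdiag : ∀ i, u i ⬝ᵥ v i = 0) (hoff : ∀ i j, i ≠ j → u i ⬝ᵥ v j ∈ S)
    {a : Fin q → K} {l : Fin q → ZMod m} (ha : ∑ j, a j = 1)
    (hS : ∀ s ∈ S, ∑ j, a j * (γ : K) ^ (l j * s).val = 0) (b : Fin k → K) (i : Fin k)
    (x : Fin h → ZMod m) :
    ∑ j, (γ : K) ^ (-(u i ⬝ᵥ x)).val * a j * matchingVectorSymbol γ u b (x + l j • v i) = b i := by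
  have hexp (r : Fin k) (j : Fin q) : (γ : K) ^ (u r ⬝ᵥ (x + l j • v i)).val =
      (γ : K) ^ (u r ⬝ᵥ x).val * (γ : K) ^ (l j * (u r ⬝ᵥ v i)).val := by
    rw [dotProduct_add, dotProduct_smul, smul_eq_mul, pow_val_add hγ]
  have hinner (r : Fin k) : ∑ j, a j * (γ : K) ^ (l j * (u r ⬝ᵥ v i)).val =
      if r = i then 1 else 0 := by
    split_ifs with h
    · subst h
      simpa [hdiag] using ha
    · exact hS _ (hoff r i h)
  have hone : (γ : K) ^ (-(u i ⬝ᵥ x)).val * (γ : K) ^ (u i ⬝ᵥ x).val = 1 := by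
    rw [← pow_val_add hγ]
    simp
  calc _ = ∑ j, ∑ r, (γ : K) ^ (-(u i ⬝ᵥ x)).val * (b r * (γ : K) ^ (u r ⬝ᵥ x).val) *
        (a j * (γ : K) ^ (l j * (u r ⬝ᵥ v i)).val) := by
        refine Finset.sum_congr rfl fun j _ => ?_
        rw [matchingVectorSymbol, Finset.mul_sum]
        refine Finset.sum_congr rfl fun r _ => ?_
        rw [hexp]
        ring
    _ = b i := by
        rw [Finset.sum_comm]
        simp only [← Finset.mul_sum, hinner]
        simp only [mul_ite, mul_one, mul_zero, Finset.sum_ite_eq', Finset.mem_univ, if_true]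
        rw [mul_left_comm, hone, mul_one]

/-- The trace takes the values `0` and `1` equally often. -/
theorem card_trace_eq_one {K : Type} [Field K] [Fintype K] [Algebra (ZMod 2) K] [DecidableEq K] :
    Fintype.card K = 2 * Fintype.card {α : K // Algebra.trace (ZMod 2) K α = 1} := by
  obtain ⟨α₁, hα₁⟩ := Algebra.trace_surjective (ZMod 2) K 1
  have hflip : ∀ t : ZMod 2, t = 1 ↔ ¬ t + 1 = 1 := by decide
  -- translation by an element of trace `1` exchanges the two values of the trace
  have hcard := Fintype.card_congr ((Equiv.addRight α₁).subtypeEquiv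
    (p := fun α => Algebra.trace (ZMod 2) K α = 1) (q := fun α => ¬ Algebra.trace (ZMod 2) K α = 1)
    fun α => by rw [Equiv.coe_addRight, map_add, hα₁]; exact hflip _)
  have := Fintype.card_congr (Equiv.sumCompl fun α => Algebra.trace (ZMod 2) K α = 1)
  rw [Fintype.card_sum, ← hcard] at this
  omega

/-- The binary matching vector code of `u`, with coordinates enumerated by `e`. -/
noncomputable def binaryMatchingVectorCode {K : Type} [Field K] [Algebra (ZMod 2) K] {m h k n : ℕ}
    (γ : Kˣ) (u : Fin k → Fin h → ZMod m) (e : Fin n ≃ K × (Fin h → ZMod m)) :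
    (Fin k → ZMod 2) →ₗ[ZMod 2] (Fin n → ZMod 2) where
  toFun b p := Algebra.trace (ZMod 2) K
    ((e p).1 * matchingVectorSymbol γ u (fun i => algebraMap (ZMod 2) K (b i)) (e p).2)
  map_add' b c := by
    ext p
    simp [matchingVectorSymbol, add_mul, Finset.sum_add_distrib, mul_add]
  map_smul' s b := by
    ext p
    simp only [matchingVectorSymbol, Pi.smul_apply, smul_eq_mul, map_mul, RingHom.id_apply,
      mul_assoc, ← Finset.mul_sum]
    rw [mul_left_comm, ← Algebra.smul_def, map_smul, smul_eq_mul]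

/-- To recover `b_i`, the decoder takes a random `α` of trace `1` and a random `x`, and reads the
traces of multiples of the symbols on the line through `x` in the direction `v_i` such that their
sum is the trace of `α b_i`. As only half of the elements of `K` have trace `1`, a query hits a
given set of `δ n` positions with probability at most `2 δ`. -/
theorem binaryMatchingVectorCode_injective_and_isLDC {K : Type} [Field K] [Finite K]
    [Algebra (ZMod 2) K]
    {m h k n q : ℕ} [NeZero m] {γ : Kˣ} (hγ : orderOf γ = m) {u v : Fin k → Fin h → ZMod m}
    {S : Finset (ZMod m)} (hdiag : ∀ i, u i ⬝ᵥ v i = 0) (hoff : ∀ i j, i ≠ j → u i ⬝ᵥ v j ∈ S)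
    {a : Fin q → K} {l : Fin q → ZMod m} (ha0 : ∀ j, a j ≠ 0) (ha : ∑ j, a j = 1)
    (hS : ∀ s ∈ S, ∑ j, a j * (γ : K) ^ (l j * s).val = 0)
    (e : Fin n ≃ K × (Fin h → ZMod m)) (δ : ℝ) :
    Function.Injective (binaryMatchingVectorCode γ u e) ∧
      IsLDC q δ (1 / 2 - 2 * q * δ) (binaryMatchingVectorCode γ u e) := by
  classical
  have : Fintype K := Fintype.ofFinite K
  let A := {α : K // Algebra.trace (ZMod 2) K α = 1}
  have hA := card_trace_eq_one (K := K)
  have hAne : Nonempty A := by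
    rw [← Fintype.card_pos_iff]
    have h : 0 < Fintype.card K := Fintype.card_pos
    rw [hA] at h
    exact pos_of_mul_pos_right h (by norm_num)
  let p : Fin k → Fin q → A × (Fin h → ZMod m) → Fin n := fun i j ω =>
    e.symm (ω.1.1 * ((γ : K) ^ (-(u i ⬝ᵥ ω.2)).val * a j), ω.2 + l j • v i)
  have hp : ∀ b i ω, ∑ j, binaryMatchingVectorCode γ u e b (p i j ω) = b i := by
    rintro b i ⟨⟨α, hα⟩, x⟩
    have h := sum_matchingVectorSymbol_line hγ hdiag hoff ha hS
      (fun i => algebraMap (ZMod 2) K (b i)) i x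
    simp only [binaryMatchingVectorCode, LinearMap.coe_mk, AddHom.coe_mk, p,
      Equiv.apply_symm_apply]
    rw [← map_sum]
    simp only [mul_assoc, ← Finset.mul_sum] at h ⊢
    rw [h, mul_comm, ← Algebra.smul_def, map_smul, hα, smul_eq_mul, mul_one]
  refine ⟨?_, isLDC_of_sum_queries p ?_ hp ?_ δ⟩
  · intro b c hbc
    obtain ⟨ω⟩ : Nonempty (A × (Fin h → ZMod m)) := inferInstance
    ext i
    rw [← hp b i ω, ← hp c i ω, hbc]
  · rintro i j ⟨⟨α, hα⟩, x⟩ ⟨⟨β, hβ⟩, y⟩ hxy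
    obtain ⟨h1, h2⟩ := Prod.mk.inj (e.symm.injective hxy)
    obtain rfl : x = y := add_right_cancel h2
    have h3 : (γ : K) ^ (-(u i ⬝ᵥ x)).val * a j ≠ 0 :=
      mul_ne_zero (pow_ne_zero _ γ.ne_zero) (ha0 j)
    obtain rfl : α = β := mul_right_cancel₀ h3 h1
    rfl
  · have := Fintype.card_congr e
    rw [Fintype.card_fin, Fintype.card_prod, hA, mul_assoc] at this
    rw [this, Fintype.card_prod]

end MatchingVectorCode

/-! ### The length of the matching vector codes -/

/-- Strings of length `w ≥ log₂ k` with `w + 1 = 7 ^ a 73 ^ b`, where both prime powers are of the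
order of `√(log k)`. -/
theorem exists_matchingVectors_exponents (k : ℕ) : ∃ a b w : ℕ, w + 1 = 7 ^ a * 73 ^ b ∧ k ≤ 2 ^ w ∧
    7 ^ a ≤ 73 ^ b ∧ 73 ≤ 73 ^ b ∧ (73 ^ b) ^ 2 ≤ 73 ^ 2 * (7 * (Nat.clog 2 k + 1)) := by
  set ℓ := Nat.clog 2 k
  set b := Nat.clog 5329 (7 * (ℓ + 1))
  set a := Nat.log 7 (73 ^ b)
  have hb : 1 ≤ b := Nat.clog_pos (by norm_num) (by omega)
  have h1 : 7 * (ℓ + 1) ≤ 5329 ^ b := Nat.le_pow_clog (by norm_num) _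
  have h2 : 5329 ^ b.pred < 7 * (ℓ + 1) := Nat.pow_pred_clog_lt_self (by norm_num) (by omega)
  have h3 : 7 ^ a ≤ 73 ^ b := Nat.pow_log_le_self 7 (by positivity)
  have h4 : 73 ^ b < 7 ^ (a + 1) := Nat.lt_pow_succ_log_self (by norm_num) _
  have h5 : (73 ^ b) ^ 2 = 5329 ^ b := by
    rw [← pow_mul, mul_comm, pow_mul]
    norm_num
  have h6 : 0 < 7 ^ a * 73 ^ b := by positivity
  refine ⟨a, b, 7 ^ a * 73 ^ b - 1, by omega, ?_, h3, ?_, ?_⟩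
  · refine (Nat.le_pow_clog (by norm_num : 1 < 2) k).trans (Nat.pow_le_pow_right (by norm_num) ?_)
    have : 7 * (ℓ + 1) < 7 * (7 ^ a * 73 ^ b) + 1 := by
      rw [pow_succ] at h4
      have : (73 ^ b) ^ 2 ≤ 7 * (7 ^ a * 73 ^ b) := by
        rw [pow_two]
        nlinarith [pow_pos (show 0 < 73 by norm_num) b]
      omega
    change ℓ ≤ _
    omega
  · exact Nat.le_self_pow (by omega) 73
  · rw [h5, ← Nat.succ_pred_eq_of_pos hb, pow_succ]
    omega

/-- The length of the code in terms of the larger prime power `M`, which is of the order of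
`√(log k)`. -/
theorem length_le_exp {h M w p : ℕ} (hM : 73 ≤ M) (hp : p ≤ M) (hw : w ≤ M ^ 2)
    (hh : h ≤ 1 + (2 * w) ^ (p - 1) + (2 * w) ^ (M - 1)) :
    (2 ^ 9 * 511 ^ h : ℝ) ≤ Real.exp (Real.exp (6 * M * Real.log M)) := by
  have hX : 1 ≤ (2 * M ^ 2) ^ (M - 1) := Nat.one_le_pow _ _ (by positivity)
  have hbase : 2 * w ≤ 2 * M ^ 2 := by omega
  have h1 : (2 * w) ^ (p - 1) ≤ (2 * M ^ 2) ^ (M - 1) :=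
    (Nat.pow_le_pow_left hbase _).trans (Nat.pow_le_pow_right (by positivity) (by omega))
  have h2 : (2 * w) ^ (M - 1) ≤ (2 * M ^ 2) ^ (M - 1) := Nat.pow_le_pow_left hbase _
  have hM3 : 2 * M ^ 2 ≤ M ^ 3 := by
    rw [pow_succ M 2, mul_comm]
    exact Nat.mul_le_mul_left _ (by omega)
  have h3 : 7 * (h + 2) ≤ (M ^ 3) ^ (M + 1) := by
    calc 7 * (h + 2) ≤ 35 * (2 * M ^ 2) ^ (M - 1) := by omega
      _ ≤ (2 * M ^ 2) ^ 2 * (2 * M ^ 2) ^ (M - 1) := by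
        refine Nat.mul_le_mul_right _ ?_
        nlinarith [Nat.pow_le_pow_left hM 2]
      _ = (2 * M ^ 2) ^ (M + 1) := by
        rw [← pow_add]
        congr 1
        omega
      _ ≤ _ := Nat.pow_le_pow_left hM3 _
  have hM0 : (0 : ℝ) < M := by
    have : 0 < M := by omega
    exact_mod_cast this
  have hM1 : (73 : ℝ) ≤ M := by exact_mod_cast hM
  have hlog : 0 ≤ Real.log M := Real.log_nonneg (by linarith)
  have h4 : (7 * (h + 2) : ℝ) ≤ Real.exp (6 * M * Real.log M) := by
    calc (7 * (h + 2) : ℝ) ≤ ((M : ℝ) ^ 3) ^ (M + 1) := by exact_mod_cast h3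
      _ = Real.exp (((3 * (M + 1) : ℕ) : ℝ) * Real.log M) := by
        rw [Real.exp_nat_mul, Real.exp_log hM0, pow_mul]
      _ ≤ _ := by
        refine Real.exp_le_exp.2 (mul_le_mul_of_nonneg_right ?_ hlog)
        push_cast
        linarith
  have h5 : (511 : ℝ) ≤ Real.exp 7 := by
    have h := Real.add_one_le_exp (1 : ℝ)
    have h' : (511 : ℝ) ≤ 2.7 ^ 7 := by norm_num
    have h'' : (2.7 : ℝ) ≤ Real.exp 1 := by linarith [Real.exp_one_gt_d9]
    refine h'.trans ((pow_le_pow_left₀ (by norm_num) h'' 7).trans (le_of_eq ?_))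
    rw [← Real.exp_nat_mul]
    norm_num
  calc (2 ^ 9 * 511 ^ h : ℝ) ≤ 511 ^ 2 * 511 ^ h := by gcongr; norm_num
    _ = 511 ^ (h + 2) := by rw [← pow_add, add_comm]
    _ ≤ Real.exp 7 ^ (h + 2) := by gcongr
    _ = Real.exp (7 * (h + 2)) := by
      rw [← Real.exp_nat_mul]
      push_cast
      ring_nf
    _ ≤ _ := Real.exp_le_exp.2 h4

/-- Additive constants are absorbed by the factor `log (log k)`, which is at least `0.08` for
`k ≥ 3`. -/
theorem mul_log_le_sqrt_log_mul {k M : ℕ} (hk : 3 ≤ k) (hM : 73 ≤ M)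
    (h : M ^ 2 ≤ 73 ^ 2 * (7 * (Nat.clog 2 k + 1))) :
    6 * M * Real.log M ≤ 300000 * (√(Real.log k) * Real.log (Real.log k)) := by
  have hk3 : (3 : ℝ) ≤ k := by exact_mod_cast hk
  have hM1 : (73 : ℝ) ≤ M := by exact_mod_cast hM
  have hx : 1.09 ≤ Real.log k := by
    have h1 := Real.one_sub_inv_le_log_of_pos (x := 3 / Real.exp 1) (by positivity)
    rw [Real.log_div (by norm_num) (Real.exp_pos 1).ne', Real.log_exp, inv_div] at h1
    have h2 := Real.exp_one_lt_d9
    have h3 := Real.log_le_log (by norm_num) hk3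
    linarith
  set x := Real.log k
  have ht : 0.08 ≤ Real.log x := by
    have h1 := Real.one_sub_inv_le_log_of_pos (x := x) (by linarith)
    have h2 : x⁻¹ ≤ 1.09⁻¹ := inv_anti₀ (by norm_num) hx
    norm_num at h1 h2 ⊢
    linarith
  have hclog : ((Nat.clog 2 k : ℕ) : ℝ) + 1 ≤ 4 * x := by
    have h1 : (2 : ℝ) ^ (Nat.clog 2 k).pred < k := by
      exact_mod_cast Nat.pow_pred_clog_lt_self (by norm_num) (by omega)
    have h2 := Real.log_lt_log (by positivity) h1
    rw [Real.log_pow] at h2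
    have h3 : 1 ≤ Nat.clog 2 k := Nat.clog_pos (by norm_num) (by omega)
    have h4 : (((Nat.clog 2 k).pred : ℕ) : ℝ) = (Nat.clog 2 k : ℝ) - 1 := by
      rw [Nat.pred_eq_sub_one, Nat.cast_sub h3, Nat.cast_one]
    rw [h4] at h2
    have h5 : (1 : ℝ) ≤ Nat.clog 2 k := by exact_mod_cast h3
    nlinarith [Real.log_two_gt_d9]
  have hs : 0 < √x := Real.sqrt_pos.2 (by linarith)
  have hss : √x ^ 2 = x := Real.sq_sqrt (by linarith)
  have hMs : (M : ℝ) ≤ 438 * √x := by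
    have h1 : (M : ℝ) ^ 2 ≤ 73 ^ 2 * (7 * ((Nat.clog 2 k : ℕ) + 1)) := by exact_mod_cast h
    refine le_of_sq_le_sq (b := 438 * √x) ?_ (by positivity) 
    nlinarith
  have hlogM : Real.log M ≤ 101 * Real.log x := by
    have h1 := Real.log_le_log (by linarith) hMs
    rw [Real.log_mul (by norm_num) hs.ne', Real.log_sqrt (by linarith)] at h1
    have h2 : Real.log 438 ≤ 7 := by
      rw [Real.log_le_iff_le_exp (by norm_num)]
      have h' : (438 : ℝ) ≤ 2.7 ^ 7 := by norm_num
      have h'' : (2.7 : ℝ) ≤ Real.exp 1 := by linarith [Real.exp_one_gt_d9]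
      refine h'.trans ((pow_le_pow_left₀ (by norm_num) h'' 7).trans (le_of_eq ?_))
      rw [← Real.exp_nat_mul]
      norm_num
    linarith
  calc 6 * M * Real.log M ≤ 6 * (438 * √x) * (101 * Real.log x) := by gcongr
    _ ≤ _ := by nlinarith [mul_pos hs (show 0 < Real.log x by linarith)]

theorem exists_short_binaryMatchingVectorCode {k : ℕ} (hk : 3 ≤ k) :
    ∃ (n : ℕ) (L : (Fin k → ZMod 2) →ₗ[ZMod 2] (Fin n → ZMod 2)),
      Function.Injective L ∧ IsBinaryMatchingVectorCode L ∧ IsLDC 3 (1 / 24) (1 / 4) L ∧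
      (n : ℝ) ≤ Real.exp (Real.exp (300000 * (√(Real.log k) * Real.log (Real.log k)))) := by
  obtain ⟨a, b, w, hw, hkw, h7, h73, hM⟩ := exists_matchingVectors_exponents k
  obtain ⟨h, u, v, hh, hdiag, hoff⟩ := exists_matchingVectors a b w k hw hkw
  obtain ⟨γ, hγ, c, l, hc0, hc, hS⟩ := exists_trinomial
  have hcard : Nat.card (GaloisField 2 9 × (Fin h → ZMod 511)) = 2 ^ 9 * 511 ^ h := by
    rw [Nat.card_prod, GaloisField.card 2 9 (by norm_num), Nat.card_fun]
    simp
  have e : Fin (2 ^ 9 * 511 ^ h) ≃ GaloisField 2 9 × (Fin h → ZMod 511) :=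
    (finCongr hcard.symm).trans (Finite.equivFin _).symm
  obtain ⟨hinj, hldc⟩ := binaryMatchingVectorCode_injective_and_isLDC hγ hdiag hoff hc0 hc hS e
    (1 / 24)
  refine ⟨_, binaryMatchingVectorCode γ u e, hinj, ?_, ?_, ?_⟩
  · refine ⟨9, 511, h, by norm_num, γ, hγ, u, v, ⟨hdiag, fun i j hij h0 => ?_⟩, e, fun b p => rfl⟩
    have := hoff i j hij
    rw [h0] at this
    revert this
    decide
  · norm_num at hldc ⊢
    exact hldc
  · have hw' : w ≤ (73 ^ b) ^ 2 := by
      have : 7 ^ a * 73 ^ b ≤ (73 ^ b) ^ 2 := by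
        rw [pow_two]
        exact Nat.mul_le_mul_right _ h7
      omega
    have h1 := length_le_exp h73 h7 hw' hh
    have h2 := mul_log_le_sqrt_log_mul hk h73 hM
    push_cast at h1 h2
    rw [Nat.cast_mul, Nat.cast_pow, Nat.cast_pow]
    exact h1.trans (Real.exp_le_exp.2 (Real.exp_le_exp.2 h2))

/-! ### Comparison of the lengths -/

open Filter Topology Asymptotics in
theorem eventually_mul_sqrt_mul_log_lt (A C : ℝ) :
    ∀ᶠ x : ℝ in atTop, C * (√x * Real.log x) < A + 1 / 8 * x := by
  have h1 : (fun x : ℝ => √x * Real.log x) =o[atTop] fun x => x := by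
    have h := (isBigO_refl (fun x : ℝ => √x) atTop).mul_isLittleO
      (isLittleO_log_rpow_atTop (show (0 : ℝ) < 1 / 2 by norm_num))
    refine h.congr' EventuallyEq.rfl ?_
    filter_upwards [eventually_ge_atTop 0] with x hx
    rw [← Real.sqrt_eq_rpow, Real.mul_self_sqrt hx]
  have h2 := (h1.const_mul_left C).def (show (0 : ℝ) < 1 / 16 by norm_num)
  filter_upwards [h2, eventually_ge_atTop 0, eventually_gt_atTop (-16 * A)] with x hx h0 hA
  rw [Real.norm_eq_abs, Real.norm_eq_abs, abs_of_nonneg h0] at hx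
  linarith [le_abs_self (C * (√x * Real.log x))]

open Filter in
/-- The bound of `IsLCC.two_rpow_le` grows like `2 ^ (c k ^ (1 / 8))`, and
`exp (C √(log k) log log k)` is smaller than any power of `k`. -/
theorem exists_forall_not_isLCC (C δ : ℝ) (hδ : 0 < δ) : ∃ K : ℕ, ∀ k : ℕ, K ≤ k →
    ∀ (n : ℕ) (L : (Fin k → ZMod 2) →ₗ[ZMod 2] (Fin n → ZMod 2)),
      Function.Injective L →
      (n : ℝ) ≤ Real.exp (Real.exp (C * (√(Real.log k) * Real.log (Real.log k)))) →
      ∀ ε > (0 : ℝ), ¬ IsLCC 3 δ ε L := by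
  set c : ℝ := Real.log 2 * (1 / 100) * (δ ^ 2) ^ (1 / 8 : ℝ) with hc
  have hc0 : 0 < c := by
    have := Real.log_pos (show (1 : ℝ) < 2 by norm_num)
    positivity
  have hlog := Real.tendsto_log_atTop.comp (tendsto_natCast_atTop_atTop (R := ℝ))
  obtain ⟨K, hK⟩ := eventually_atTop.1
    (hlog.eventually (eventually_mul_sqrt_mul_log_lt (Real.log c) C))
  refine ⟨max K 2, fun k hk n L hL hn ε hε hLCC => ?_⟩
  have hk2 : 2 ≤ k := (le_max_right _ _).trans hk
  have hk0 : (0 : ℝ) < k := by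
    have : 0 < k := by omega
    exact_mod_cast this
  have hkn : k ≤ n := by
    simpa using LinearMap.finrank_le_finrank_of_injective hL
  have h1 := IsLCC.two_rpow_le (hk2.trans hkn) hL hδ hε hLCC
  have h2 := hK k ((le_max_left _ _).trans hk)
  simp only [Function.comp_apply] at h2
  have h3 := h1.trans hn
  rw [ZMod.card, Real.rpow_def_of_pos (by norm_num), Real.exp_le_exp] at h3
  have h4 : Real.log 2 * (1 / 100 * (δ ^ 2 * k / (((2 : ℕ) : ℝ) - 1) ^ 2) ^ (1 / 8 : ℝ)) =
      Real.exp (Real.log c + 1 / 8 * Real.log k) := by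
    rw [show δ ^ 2 * k / (((2 : ℕ) : ℝ) - 1) ^ 2 = δ ^ 2 * k by norm_num, Real.exp_add,
      Real.exp_log hc0, Real.mul_rpow (by positivity) hk0.le,
      Real.rpow_def_of_pos hk0, hc, mul_comm (1 / 8 : ℝ) (Real.log k)]
    ring
  rw [h4, Real.exp_le_exp] at h3
  exact absurd h3 (not_le.2 h2)

theorem mainTheorem4 :
    -- subexponential linear 3-LDCs over `𝔽₂` exist, namely matching vector codes
    (∃ δ > (0 : ℝ), ∃ ε > (0 : ℝ), ∃ C > (0 : ℝ), ∀ k : ℕ, 3 ≤ k →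
      ∃ (n : ℕ) (L : (Fin k → ZMod 2) →ₗ[ZMod 2] (Fin n → ZMod 2)),
        Function.Injective L ∧ IsBinaryMatchingVectorCode L ∧ IsLDC 3 δ ε L ∧
        (n : ℝ) ≤ Real.exp (Real.exp (C * (√(Real.log k) * Real.log (Real.log k))))) ∧
    -- linear 3-LCCs have exponential length
    (∃ c > (0 : ℝ), ∀ (F : Type) [Field F] [Fintype F] [DecidableEq F] (k n : ℕ)
      (L : (Fin k → F) →ₗ[F] (Fin n → F)) (δ ε : ℝ),
        2 ≤ n → Function.Injective L → 0 < δ → 0 < ε → IsLCC 3 δ ε L →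
        (2 : ℝ) ^ (c * (δ ^ 2 * k / ((Fintype.card F : ℝ) - 1) ^ 2) ^ (1 / 8 : ℝ)) ≤ n) ∧
    -- hence linear codes over `𝔽₂` as short as those matching vector codes are not 3-LCCs
    (∀ C : ℝ, ∀ δ > (0 : ℝ), ∃ K : ℕ, ∀ k : ℕ, K ≤ k →
      ∀ (n : ℕ) (L : (Fin k → ZMod 2) →ₗ[ZMod 2] (Fin n → ZMod 2)),
        Function.Injective L →
        (n : ℝ) ≤ Real.exp (Real.exp (C * (√(Real.log k) * Real.log (Real.log k)))) →
        ∀ ε > (0 : ℝ), ¬ IsLCC 3 δ ε L) := by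
  refine ⟨⟨1 / 24, by norm_num, 1 / 4, by norm_num, 300000, by norm_num, fun k hk =>
      exists_short_binaryMatchingVectorCode hk⟩,
    ⟨1 / 100, by norm_num, fun F _ _ _ k n L δ ε hn hL hδ hε h =>
      IsLCC.two_rpow_le hn hL hδ hε h⟩, exists_forall_not_isLCC⟩
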